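/- Let $N\ge 1$ and index by $\omega\in\mathbb Z/N$. Let $K$ be a commutative ring "of functions of $x$" on which an abelian group $G$ acts by ring automorphisms, written as translations $f(x)\mapsto f(x+a)$, $a\in G$ (for example, $K$ the field of meromorphic functions on $\mathbb C$ and $G=\mathbb C$), and let $\epsilon,m\in G$ (here $\epsilon_1=0$, so $\epsilon=\epsilon_2$). Let $K[[\mathfrak q]]=K[[\mathfrak q_\omega:\omega\in\mathbb Z/N]]$, with translations acting coefficientwise, and let $Y_\omega(x)\in K[[\mathfrak q]]$ ($\omega\in\mathbb Z/N$) be arbitrary invertible elements. For a Young diagram $\lambda$ with column lengths $\lambda_j^t$, and its box $(i,j)$ in row $i$ and column $j$, put $\sigma_{(ij)}=m(i-j)+\epsilon(1-j)$. The orbifolded qq-character at $\epsilon_1=0$ is $$\chi_\omega(x)=Y_{\omega+1}(x+\epsilon)\sum_{\lambda}\ \prod_{j=1}^{\lambda_1}\mathfrak q_{\omega+1-j}^{\lambda_j^t}\prod_{(ij)\in\lambda}\frac{Y_{\omega+2-j}(x+\sigma_{(ij)}+m+\epsilon)\,Y_{\omega+1-j}(x+\sigma_{(ij)}-m)}{Y_{\omega+2-j}(x+\sigma_{(ij)}+\epsilon)\,Y_{\omega+1-j}(x+\sigma_{(ij)})},$$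 the sum being over all Young diagrams. Define $N\times N$ matrices $\hat Y(x)=\mathrm{diag}(Y_{\omega+1}(x))$, $\hat\chi(x)=\mathrm{diag}(\chi_\omega(x))$, $\hat Q=\mathrm{diag}(\mathfrak q_\omega)$, $C=\sum_\omega e_\omega\otimes e_{\omega+1}^t$, and $$D_n=\Big(\prod_{k=0}^{n-1}\hat Q^{\,n-k}C^{-1}\Big)C^n\quad(n\ge 0),\qquad D_n=\prod_{k=1}^{-n-1}C^k(\hat QC^{-1})^k\quad(n<0),$$ factors with larger $k$ standing further to the right. Let $\mathcal A$ be the ring of formal power series in the central variables $\mathfrak q_\omega$ whose coefficients are finite sums $\sum_{k\in\mathbb Z,\,a\in G}A_{k,a}(x)\,z^{k/N}e^{a\partial_x}$ with $A_{k,a}\in\mathrm{Mat}_N(K)$, where $z^{1/N}$ is a central invertible formal parameter, $e^{a\partial_x}e^{b\partial_x}=e^{(a+b)\partial_x}$ and $e^{a\partial_x}A(x)=A(x+a)e^{a\partial_x}$. All limits and infinite sums, in $\mathcal A$ and in $K[[\mathfrak q]]$, are taken in the topology in which a net converges if and only if the coefficient of each monomial in the $\mathfrak q_\omega$ is eventually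 constant. **Theorem.** The sums defining $\chi_\omega(x)$ converge, the two infinite ordered products below converge in $\mathcal A$, the sum over $n\in\mathbb Z$ below converges unconditionally in $\mathcal A$, and $$\overleftarrow{\prod_{n=1}^{\infty}}\Big(1-z^{\frac1N}\hat Q^n\hat Y(x+nm+\epsilon)C^{-1}e^{-\epsilon\partial_x}\hat Y(x+(n-1)m+\epsilon)^{-1}\Big)\ \hat Y(x+\epsilon)\ \overrightarrow{\prod_{n=0}^{\infty}}\Big(1-z^{-\frac1N}e^{\epsilon\partial_x}(\hat QC^{-1})^n\frac{\hat Y(x-(n+1)m-n\epsilon)}{\hat Y(x-nm-n\epsilon)}C^{n+1}\Big)$$ $$=\ \sum_{n\in\mathbb Z}(-1)^n z^{\frac nN}\,\hat\chi(x+nm)\,D_n\,C^{-n}\,e^{-n\epsilon\partial_x}.$$ Here the arrow over a product points in the direction in which $n$ increases: in the first product the factors with larger $n$ stand further to the left, in the second further to the right. -/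

import Mathlib

open Filter Topology

namespace QQFactorization

noncomputable section

/-! ### Formal power series in the couplings

`MvPowerSeries (ZMod N) R` is the ring of formal power series in the (central, commuting)
couplings `𝔮_ω`, `ω ∈ ℤ/N`.  It carries the topology of coefficientwise stabilization: the
coefficients are discrete, so a net converges iff every coefficient is eventually constant. -/

/-- The topology of coefficientwise stabilization on power series in the couplings. -/
instance couplingTopology (N : ℕ) (R : Type*) : TopologicalSpace (MvPowerSeries (ZMod N) R) :=
  @MvPowerSeries.WithPiTopology.instTopologicalSpace (ZMod N) R ⊥

instance couplingT2Space (N : ℕ) (R : Type*) : T2Space (MvPowerSeries (ZMod N) R) := by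
  let _ : TopologicalSpace R := ⊥
  have : DiscreteTopology R := ⟨rfl⟩
  exact MvPowerSeries.WithPiTopology.instT2Space

/-! ### Ordered products -/

/-- `f (k-1) * ⋯ * f 1 * f 0`, each new factor being put on the left. -/
def leftOrderedProd {A : Type*} [Monoid A] (f : ℕ → A) : ℕ → A
  | 0 => 1
  | k + 1 => f k * leftOrderedProd f k

/-- `f 0 * f 1 * ⋯ * f (k-1)`, each new factor being put on the right. -/
def rightOrderedProd {A : Type*} [Monoid A] (f : ℕ → A) : ℕ → A
  | 0 => 1
  | k + 1 => rightOrderedProd f k * f k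

/-! ### Functions of `x` and their translations

`K` is the ring of functions of `x` and the additive group `G` acts on it by ring automorphisms,
the action of `a` being the translation `f(x) ↦ f(x + a)`.  The basic example is the field of
meromorphic functions of `x ∈ ℂ`, with `G = ℂ`. -/

section Functions

variable {G K : Type*} [AddCommGroup G] [CommRing K] [MulSemiringAction (Multiplicative G) K]

/-- The translation `f(x) ↦ f(x + a)`, applied to each coefficient of a power series in the
couplings. -/
def translate (N : ℕ) (a : G) : MvPowerSeries (ZMod N) K →+* MvPowerSeries (ZMod N) K :=
  MvPowerSeries.map (MulSemiringAction.toRingHom (Multiplicative G) K (Multiplicative.ofAdd a))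

/-! ### The qq-character at `ε₁ = 0` -/

/-- The summand of `χ_ω(x)` at the Young diagram `μ`.  The cells of `μ` are numbered from zero, so
the cell `(i, j)` here is the box in row `i + 1` and column `j + 1`, with
`σ = i m - j (m + ε)`. -/
def qqTerm {N : ℕ} (ε m : G) (Y : ZMod N → MvPowerSeries (ZMod N) K) (ω : ZMod N)
    (μ : YoungDiagram) : MvPowerSeries (ZMod N) K :=
  let σ : ℕ × ℕ → G := fun c => c.1 • m - c.2 • (m + ε)
  translate N ε (Y (ω + 1)) *
    (∏ j ∈ Finset.range (μ.rowLen 0), MvPowerSeries.X (ω - (j : ZMod N)) ^ μ.colLen j) *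
    ∏ c ∈ μ.cells,
      (translate N (σ c + m + ε) (Y (ω + 1 - (c.2 : ZMod N))) *
          translate N (σ c - m) (Y (ω - (c.2 : ZMod N)))) *
        Ring.inverse
          (translate N (σ c + ε) (Y (ω + 1 - (c.2 : ZMod N))) *
            translate N (σ c) (Y (ω - (c.2 : ZMod N))))

/-- The orbifolded qq-character `χ_ω(x)` at `ε₁ = 0`, a sum over all Young diagrams. -/
def qqCharacter {N : ℕ} (ε m : G) (Y : ZMod N → MvPowerSeries (ZMod N) K) (ω : ZMod N) :
    MvPowerSeries (ZMod N) K :=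
  ∑' μ : YoungDiagram, qqTerm ε m Y ω μ

/-! ### The `N × N` matrices -/

/-- `Ŷ(x + a) = diag(Y_{ω+1}(x + a))`. -/
def hatY {N : ℕ} (Y : ZMod N → MvPowerSeries (ZMod N) K) (a : G) :
    Matrix (ZMod N) (ZMod N) (MvPowerSeries (ZMod N) K) :=
  Matrix.diagonal fun ω => translate N a (Y (ω + 1))

/-- `χ̂(x + a) = diag(χ_ω(x + a))`. -/
def hatChi {N : ℕ} (ε m : G) (Y : ZMod N → MvPowerSeries (ZMod N) K) (a : G) :
    Matrix (ZMod N) (ZMod N) (MvPowerSeries (ZMod N) K) :=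
  Matrix.diagonal fun ω => translate N a (qqCharacter ε m Y ω)

end Functions

section Matrices

variable (N : ℕ) (K : Type*) [CommRing K]

/-- The diagonal matrix of couplings `diag(𝔮_ω)`. -/
def couplingMatrix : Matrix (ZMod N) (ZMod N) (MvPowerSeries (ZMod N) K) :=
  Matrix.diagonal fun ω => MvPowerSeries.X ω

/-- The cyclic shift matrix `C = ∑ e_ω ⊗ e_{ω+1}ᵗ`. -/
def cyclicShift : Matrix (ZMod N) (ZMod N) (MvPowerSeries (ZMod N) K) :=
  Matrix.of fun ω ω' => if ω' = ω + 1 then 1 else 0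

/-- The diagonal matrix `D_n`: it is `(𝔔ⁿ C⁻¹)(𝔔ⁿ⁻¹ C⁻¹) ⋯ (𝔔 C⁻¹) Cⁿ` for `n ≥ 0`, and
`∏_{k=1}^{-n-1} C^k (𝔔 C⁻¹)^k` for `n < 0`, where `𝔔 = diag(𝔮_ω)`. -/
def couplingFactor [NeZero N] : ℤ → Matrix (ZMod N) (ZMod N) (MvPowerSeries (ZMod N) K)
  | Int.ofNat n =>
      rightOrderedProd (fun k => couplingMatrix N K ^ (n - k) * (cyclicShift N K)⁻¹) n *
        cyclicShift N K ^ n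
  | Int.negSucc n =>
      rightOrderedProd (fun k => cyclicShift N K ^ (k + 1) *
        (couplingMatrix N K * (cyclicShift N K)⁻¹) ^ (k + 1)) n

end Matrices

/-! ### Matrix difference operators

The monomials `z^{k/N} e^{a ∂ₓ}` form the group `Multiplicative (ℤ × G)`; it acts on matrices of
functions by `f(x) ↦ f(x + a)`, the formal parameter `z^{1/N}` acting trivially. -/

section Operators

variable {N : ℕ} {G K : Type*} [AddCommGroup G] [CommRing K]
  [MulSemiringAction (Multiplicative G) K]

instance matrixTranslation [NeZero N] :
    MulSemiringAction (Multiplicative (ℤ × G)) (Matrix (ZMod N) (ZMod N) K) where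
  smul g M := M.map fun f => Multiplicative.ofAdd g.toAdd.2 • f
  one_smul M := by
    ext i j
    exact one_smul (Multiplicative G) (M i j)
  mul_smul g h M := by
    ext i j
    exact mul_smul (Multiplicative.ofAdd g.toAdd.2) (Multiplicative.ofAdd h.toAdd.2) (M i j)
  smul_zero g := by
    ext i j
    exact smul_zero (Multiplicative.ofAdd g.toAdd.2)
  smul_add g M M' := by
    ext i j
    exact smul_add (Multiplicative.ofAdd g.toAdd.2) (M i j) (M' i j)
  smul_one g := by
    exact Matrix.map_one _ (smul_zero _) (smul_one _)
  smul_mul g M M' := by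
    exact Matrix.map_mul
      (f := MulSemiringAction.toRingHom (Multiplicative G) K (Multiplicative.ofAdd g.toAdd.2))

/-- Formal `N × N` matrix difference operators: power series in the couplings whose coefficients
are finite sums `∑ A_{k,a}(x) z^{k/N} e^{a ∂ₓ}` with `A_{k,a}` an `N × N` matrix of functions.
The multiplication rule is `e^{a ∂ₓ} A(x) = A(x + a) e^{a ∂ₓ}`; `z^{1/N}` and the couplings are
central. -/
abbrev DiffOp (N : ℕ) [NeZero N] (G K : Type*) [AddCommGroup G] [CommRing K]
    [MulSemiringAction (Multiplicative G) K] : Type _ :=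
  MvPowerSeries (ZMod N)
    (SkewMonoidAlgebra (Matrix (ZMod N) (ZMod N) K) (Multiplicative (ℤ × G)))

variable [NeZero N]

variable (G) in
/-- A matrix of functions, regarded as a multiplication operator. -/
def ofMatrix (A : Matrix (ZMod N) (ZMod N) (MvPowerSeries (ZMod N) K)) : DiffOp N G K :=
  fun d => SkewMonoidAlgebra.single 1 (A.map fun f => MvPowerSeries.coeff d f)

variable (N G K) in
/-- The operator `z^{k/N}`. -/
def zPow (k : ℤ) : DiffOp N G K :=
  MvPowerSeries.C (SkewMonoidAlgebra.single (Multiplicative.ofAdd (k, 0)) 1)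

variable (N K) in
/-- The operator `e^{a ∂ₓ}`. -/
def shiftOp (a : G) : DiffOp N G K :=
  MvPowerSeries.C (SkewMonoidAlgebra.single (Multiplicative.ofAdd (0, a)) 1)

/-- `1 - z^{1/N} 𝔔ⁿ Ŷ(x + n m + ε) C⁻¹ e^{-ε∂ₓ} Ŷ(x + (n-1) m + ε)⁻¹`. -/
def leftFactor (ε m : G) (Y : ZMod N → MvPowerSeries (ZMod N) K) (n : ℕ) : DiffOp N G K :=
  1 - zPow N G K 1 *
    ofMatrix G (couplingMatrix N K ^ n * hatY Y (n • m + ε) * (cyclicShift N K)⁻¹) *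
    shiftOp N K (-ε) *
    ofMatrix G ((hatY Y (((n : ℤ) - 1) • m + ε))⁻¹)

/-- `1 - z^{-1/N} e^{ε∂ₓ} (𝔔 C⁻¹)ⁿ Ŷ(x - (n+1) m - n ε) Ŷ(x - n m - n ε)⁻¹ C^{n+1}`. -/
def rightFactor (ε m : G) (Y : ZMod N → MvPowerSeries (ZMod N) K) (n : ℕ) : DiffOp N G K :=
  1 - zPow N G K (-1) * shiftOp N K ε *
    ofMatrix G ((couplingMatrix N K * (cyclicShift N K)⁻¹) ^ n *
      (hatY Y (-((n + 1) • m) - n • ε) * (hatY Y (-(n • m) - n • ε))⁻¹) *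
      cyclicShift N K ^ (n + 1))

/-- The summand `(-1)ⁿ z^{n/N} χ̂(x + n m) D_n C^{-n} e^{-nε∂ₓ}` of the `θ`-transform. -/
def thetaTerm (ε m : G) (Y : ZMod N → MvPowerSeries (ZMod N) K) (n : ℤ) : DiffOp N G K :=
  (-1) ^ n.natAbs * zPow N G K n *
    ofMatrix G (hatChi ε m Y (n • m) * couplingFactor N K n * cyclicShift N K ^ (-n)) *
    shiftOp N K (-(n • ε))

end Operators

end

end QQFactorization

/-!
The factorization is an operator form of the Jacobi triple product, and it is proved by expanding
the two infinite products and matching the terms with charged Young diagrams `(n, μ)`, `n ∈ ℤ`.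

All operators involved are combinations of `z^{n/N} diag(a_ω) C^{-n} e^{-nε∂ₓ}` (`monomialOp`).
These multiply like monomials, up to a shift of `ω` and a translation of `x` in the second
coefficient (`monomialOp_mul`).  Each left factor has the form `1 - monomialOp ε 1 _` and each right
factor the form `1 - monomialOp ε (-1) _`, while the summand of the right-hand side of charge `n` is
a sum over `μ` of operators `chargedTerm` of charge `n`.

The box weights of a Young diagram telescope along rows and along columns.  Hence prepending a
column of length `P - n` to a diagram of charge `n`, and raising the charge by one, multiplies
`chargedTerm` from the left by minus the monomial in the left factor of index `P + 1`
(`chargedTerm_raise`).  Likewise, prepending a row of length `n + M` and lowering the charge by one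
multiplies it from the right by minus the monomial in the right factor of index `M`
(`chargedTerm_lower`).

Let `chargedBox P M` be the finite set of pairs `(n, μ)` such that `μ` has at most `P - n` rows and
at most `n + M` columns.  A pair in `chargedBox (P + 1) M` that is not in `chargedBox P M` has a
first column of the maximal length `P + 1 - n`, so it arises from a unique pair in `chargedBox P M`
by prepending that column; the same holds for `M` and rows.  By induction, the product of the first
`P` left factors, `Ŷ(x + ε)` and the first `M` right factors is the sum of `chargedTerm` over
`chargedBox P M` (`truncated_factorization`).

The factors of index `k` differ from `1` in orders at least `k` in the couplings, which gives the
convergence of the products.  It also shows that `chargedTerm` has order at least `k` outside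
`chargedBox k k` (`le_order_chargedTerm`), so that it is summable over all pairs `(n, μ)`, and in
charge zero this is the convergence of the qq-characters.  Letting `P = M → ∞` in the truncated
identity and summing first over `μ` gives the theorem.
-/

/-! ### Prepending columns and rows to Young diagrams -/

namespace YoungDiagram

/-- The Young diagram obtained from `μ` by prepending a column of length `p`.  Rows of `μ` below
row `p` are discarded, so that the definition makes sense for every `p`; it is used only when `μ`
has at most `p` rows. -/
def consCol (p : ℕ) (μ : YoungDiagram) : YoungDiagram where
  cells := (Finset.range p ×ˢ Finset.range (μ.rowLen 0 + 1)).filter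
    fun c => c.2 = 0 ∨ (c.1, c.2 - 1) ∈ μ
  isLowerSet := by
    rintro ⟨i, j⟩ ⟨i', j'⟩ h hc
    obtain ⟨hi, hj⟩ : i' ≤ i ∧ j' ≤ j := h
    simp only [Finset.coe_filter, Finset.mem_product, Finset.mem_range, Set.mem_ofPred_eq] at hc ⊢
    refine ⟨⟨by omega, by omega⟩, ?_⟩
    rcases hc.2 with h0 | h1
    · left; omega
    · right; exact μ.up_left_mem hi (by omega) h1

theorem mem_consCol {p : ℕ} {μ : YoungDiagram} {i j : ℕ} :
    (i, j) ∈ μ.consCol p ↔ i < p ∧ (j = 0 ∨ (i, j - 1) ∈ μ) := by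
  rw [← mem_cells]
  simp only [consCol, Finset.mem_filter, Finset.mem_product, Finset.mem_range]
  refine ⟨fun h => ⟨h.1.1, h.2⟩, fun h => ⟨⟨h.1, ?_⟩, h.2⟩⟩
  rcases h.2 with h0 | h1
  · omega
  · have := mem_iff_lt_rowLen.1 (μ.up_left_mem (Nat.zero_le i) le_rfl h1)
    omega

/-- The Young diagram `μ` with its first column removed. -/
def tailCol (μ : YoungDiagram) : YoungDiagram where
  cells := μ.cells.filter fun c => (c.1, c.2 + 1) ∈ μ
  isLowerSet := by
    rintro ⟨i, j⟩ ⟨i', j'⟩ h hc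
    obtain ⟨hi, hj⟩ : i' ≤ i ∧ j' ≤ j := h
    simp only [Finset.coe_filter, mem_cells, Set.mem_ofPred_eq] at hc ⊢
    exact ⟨μ.up_left_mem hi hj hc.1, μ.up_left_mem hi (by omega) hc.2⟩

theorem mem_tailCol {μ : YoungDiagram} {i j : ℕ} : (i, j) ∈ μ.tailCol ↔ (i, j + 1) ∈ μ := by
  rw [← mem_cells]
  simp only [tailCol, Finset.mem_filter, mem_cells]
  exact ⟨fun h => h.2, fun h => ⟨μ.up_left_mem le_rfl (Nat.le_succ j) h, h⟩⟩

theorem ext_mem {μ ν : YoungDiagram} (h : ∀ i j, (i, j) ∈ μ ↔ (i, j) ∈ ν) : μ = ν := by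
  ext ⟨i, j⟩
  exact h i j

theorem lt_of_mem_of_colLen_le {μ : YoungDiagram} {p i j : ℕ} (hp : μ.colLen 0 ≤ p)
    (h : (i, j) ∈ μ) : i < p :=
  (mem_iff_lt_colLen.1 (μ.up_left_mem le_rfl (Nat.zero_le j) h)).trans_le hp

theorem tailCol_consCol {p : ℕ} {μ : YoungDiagram} (hp : μ.colLen 0 ≤ p) :
    (μ.consCol p).tailCol = μ := by
  refine ext_mem fun i j => ?_
  simp only [mem_tailCol, mem_consCol, Nat.add_one_ne_zero, false_or, Nat.add_sub_cancel]
  exact ⟨fun h => h.2, fun h => ⟨lt_of_mem_of_colLen_le hp h, h⟩⟩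

theorem consCol_tailCol (μ : YoungDiagram) : μ.tailCol.consCol (μ.colLen 0) = μ := by
  refine ext_mem fun i j => ?_
  simp only [mem_tailCol, mem_consCol]
  rcases j with _ | j
  · simp [← mem_iff_lt_colLen]
  · simp only [Nat.add_one_ne_zero, false_or, Nat.add_sub_cancel]
    exact ⟨fun h => h.2, fun h => ⟨lt_of_mem_of_colLen_le le_rfl h, h⟩⟩

theorem colLen_consCol (p : ℕ) (μ : YoungDiagram) : (μ.consCol p).colLen 0 = p := by
  refine eq_of_forall_lt_iff fun i => ?_
  simp [← mem_iff_lt_colLen, mem_consCol]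

theorem rowLen_consCol_of_pos {p : ℕ} (hp : 0 < p) (μ : YoungDiagram) :
    (μ.consCol p).rowLen 0 = μ.rowLen 0 + 1 := by
  refine eq_of_forall_lt_iff fun j => ?_
  rw [← mem_iff_lt_rowLen, mem_consCol]
  rcases j with _ | j
  · simp [hp]
  · simp [hp, mem_iff_lt_rowLen]

theorem rowLen_consCol_zero (μ : YoungDiagram) : (μ.consCol 0).rowLen 0 = 0 := by
  refine Nat.eq_zero_of_not_pos fun h => ?_
  have := mem_iff_lt_rowLen.2 h
  simp [mem_consCol] at this

theorem colLen_tailCol_le (μ : YoungDiagram) : μ.tailCol.colLen 0 ≤ μ.colLen 0 := by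
  refine le_of_forall_lt fun i h => ?_
  rw [← mem_iff_lt_colLen, mem_tailCol] at h
  exact mem_iff_lt_colLen.1 (μ.up_left_mem le_rfl (Nat.zero_le _) h)

theorem rowLen_tailCol (μ : YoungDiagram) : μ.tailCol.rowLen 0 = μ.rowLen 0 - 1 := by
  refine eq_of_forall_lt_iff fun j => ?_
  rw [← mem_iff_lt_rowLen, mem_tailCol, mem_iff_lt_rowLen]
  omega

theorem colLen_eq_zero_of_rowLen_eq_zero {μ : YoungDiagram} (h : μ.rowLen 0 = 0) :
    μ.colLen 0 = 0 := by
  by_contra h'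
  have := mem_iff_lt_rowLen.1 (mem_iff_lt_colLen.2 (Nat.pos_of_ne_zero h'))
  omega

theorem prod_cells_consCol {M : Type*} [CommMonoid M] {p : ℕ} {μ : YoungDiagram}
    (hp : μ.colLen 0 ≤ p) (f : ℕ × ℕ → M) :
    ∏ c ∈ (μ.consCol p).cells, f c =
      (∏ i ∈ Finset.range p, f (i, 0)) * ∏ c ∈ μ.cells, f (c.1, c.2 + 1) := by
  rw [← Finset.prod_filter_mul_prod_filter_not _ (fun c : ℕ × ℕ => c.2 = 0)]
  congr 1
  · refine Finset.prod_nbij' (fun c => c.1) (fun i => (i, 0)) ?_ ?_ ?_ ?_ ?_ <;>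
      simp +contextual [mem_consCol]
  · refine Finset.prod_nbij' (fun c => (c.1, c.2 - 1)) (fun c => (c.1, c.2 + 1)) ?_ ?_ ?_ ?_ ?_
    · rintro ⟨i, j⟩ h
      simp only [Finset.mem_filter, mem_cells, mem_consCol] at h ⊢
      exact h.1.2.resolve_left h.2
    · rintro ⟨i, j⟩ h
      simp only [mem_cells] at h
      simp [mem_consCol, h, lt_of_mem_of_colLen_le hp h]
    · rintro ⟨i, j⟩ h
      simp only [Finset.mem_filter] at h
      simp only [Prod.mk.injEq, true_and]
      omega
    · simp
    · rintro ⟨i, j⟩ h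
      simp only [Finset.mem_filter] at h
      rw [Nat.sub_add_cancel (by omega)]

theorem prod_cells_transpose {M : Type*} [CommMonoid M] (μ : YoungDiagram) (f : ℕ × ℕ → M) :
    ∏ c ∈ μ.transpose.cells, f c = ∏ c ∈ μ.cells, f c.swap := by
  refine Finset.prod_nbij' Prod.swap Prod.swap ?_ ?_ ?_ ?_ ?_ <;> simp [mem_transpose]

/-- The Young diagram obtained from `μ` by prepending a row of length `p`, with the columns of `μ`
beyond the `p`-th discarded. -/
def consRow (p : ℕ) (μ : YoungDiagram) : YoungDiagram :=
  (μ.transpose.consCol p).transpose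

theorem prod_cells_consRow {M : Type*} [CommMonoid M] {p : ℕ} {μ : YoungDiagram}
    (hp : μ.rowLen 0 ≤ p) (f : ℕ × ℕ → M) :
    ∏ c ∈ (μ.consRow p).cells, f c =
      (∏ j ∈ Finset.range p, f (0, j)) * ∏ c ∈ μ.cells, f (c.1 + 1, c.2) := by
  rw [consRow, prod_cells_transpose, prod_cells_consCol (by rwa [colLen_transpose]),
    prod_cells_transpose]
  rfl

/-- The cells of a Young diagram, grouped by columns. -/
theorem prod_cells_snd {M : Type*} [CommMonoid M] (μ : YoungDiagram) (f : ℕ → M) :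
    ∏ c ∈ μ.cells, f c.2 = ∏ j ∈ Finset.range (μ.rowLen 0), f j ^ μ.colLen j := by
  have hmap : ∀ c ∈ μ.cells, c.2 ∈ Finset.range (μ.rowLen 0) := by
    rintro ⟨i, j⟩ h
    exact Finset.mem_range.2 (mem_iff_lt_rowLen.1 (μ.up_left_mem (Nat.zero_le i) le_rfl h))
  rw [← Finset.prod_fiberwise_of_maps_to hmap]
  refine Finset.prod_congr rfl fun j _ => ?_
  rw [colLen_eq_card, col]
  exact Finset.prod_eq_pow_card fun c hc => by rw [(Finset.mem_filter.1 hc).2]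

end YoungDiagram

namespace QQFactorization

open YoungDiagram

/-! ### Charged Young diagrams -/

theorem finite_chargedBox (P M : ℕ) :
    {x : ℤ × YoungDiagram | (x.2.colLen 0 : ℤ) ≤ P - x.1 ∧
      (x.2.rowLen 0 : ℤ) ≤ x.1 + M}.Finite := by
  have h : {μ : YoungDiagram | μ.cells ∈
      (Finset.range (P + M) ×ˢ Finset.range (P + M)).powerset}.Finite :=
    (Finset.finite_toSet _).preimage fun μ _ ν _ h => YoungDiagram.ext h
  refine ((Set.finite_Icc (-(M : ℤ)) P).prod h).subset ?_
  rintro ⟨n, μ⟩ ⟨h₁, h₂⟩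
  simp only [Set.mem_prod, Set.mem_Icc, Set.mem_ofPred_eq, Finset.mem_powerset] at h₁ h₂ ⊢
  refine ⟨by omega, ?_⟩
  rintro ⟨i, j⟩ hc
  rw [mem_cells] at hc
  have hi := mem_iff_lt_colLen.1 (μ.up_left_mem le_rfl (Nat.zero_le j) hc)
  have hj := mem_iff_lt_rowLen.1 (μ.up_left_mem (Nat.zero_le i) le_rfl hc)
  simp only [Finset.mem_product, Finset.mem_range]
  omega

/-- The pairs `(n, μ)` of a charge and a Young diagram with at most `P - n` rows and at most
`n + M` columns; both bounds being nonnegative forces `-M ≤ n ≤ P`. -/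
noncomputable def chargedBox (P M : ℕ) : Finset (ℤ × YoungDiagram) :=
  (finite_chargedBox P M).toFinset

theorem mem_chargedBox {P M : ℕ} {n : ℤ} {μ : YoungDiagram} :
    (n, μ) ∈ chargedBox P M ↔ (μ.colLen 0 : ℤ) ≤ P - n ∧ (μ.rowLen 0 : ℤ) ≤ n + M := by
  simp [chargedBox]

theorem chargedBox_zero_zero : chargedBox 0 0 = {(0, ⊥)} := by
  ext ⟨n, μ⟩
  rw [mem_chargedBox, Finset.mem_singleton, Prod.mk.injEq]
  constructor
  · rintro ⟨h₁, h₂⟩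
    refine ⟨by omega, ext_mem fun i j => ?_⟩
    have : μ.colLen 0 = 0 := by omega
    simp only [notMem_bot, iff_false]
    intro h
    exact absurd (lt_of_mem_of_colLen_le this.le h) (Nat.not_lt_zero i)
  · rintro ⟨rfl, rfl⟩
    have h₁ : (⊥ : YoungDiagram).colLen 0 = 0 := by
      by_contra h
      exact notMem_bot _ (mem_iff_lt_colLen.2 (Nat.pos_of_ne_zero h))
    have h₂ : (⊥ : YoungDiagram).rowLen 0 = 0 := by
      by_contra h
      exact notMem_bot _ (mem_iff_lt_rowLen.2 (Nat.pos_of_ne_zero h))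
    simp [h₁, h₂]

theorem chargedBox_mono {P P' M M' : ℕ} (hP : P ≤ P') (hM : M ≤ M') :
    chargedBox P M ⊆ chargedBox P' M' := by
  rintro ⟨n, μ⟩ h
  rw [mem_chargedBox] at h ⊢
  omega

/-- Raise the charge by one and prepend the longest column that the bound `P` allows. -/
def raise (P : ℕ) (x : ℤ × YoungDiagram) : ℤ × YoungDiagram :=
  (x.1 + 1, x.2.consCol ((P : ℤ) - x.1).toNat)

/-- Lower the charge by one and prepend the longest row that the bound `M` allows. -/
def lower (M : ℕ) (x : ℤ × YoungDiagram) : ℤ × YoungDiagram :=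
  (x.1 - 1, x.2.consRow (x.1 + (M : ℤ)).toNat)

theorem injOn_raise (P M : ℕ) : Set.InjOn (raise P) (chargedBox P M) := by
  rintro ⟨n, μ⟩ hx ⟨n', μ'⟩ hx' h
  rw [Finset.mem_coe, mem_chargedBox] at hx hx'
  obtain ⟨h₁, h₂⟩ := Prod.mk.inj h
  obtain rfl : n = n' := by simpa using h₁
  have := congrArg tailCol h₂
  rw [tailCol_consCol (by grind), tailCol_consCol (by grind)] at this
  exact Prod.ext rfl this

theorem disjoint_image_raise (P M : ℕ) [DecidableEq (ℤ × YoungDiagram)] :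
    Disjoint (chargedBox P M) ((chargedBox P M).image (raise P)) := by
  rw [Finset.disjoint_right]
  intro x hx
  obtain ⟨⟨n, μ⟩, h, rfl⟩ := Finset.mem_image.1 hx
  rw [raise, mem_chargedBox, colLen_consCol]
  rw [mem_chargedBox] at h
  dsimp only
  omega

/-- A diagram in the box of bounds `P + 1` and `M` that is not in the box of bounds `P` and `M` has
a first column of maximal length. -/
theorem chargedBox_succ_left (P M : ℕ) [DecidableEq (ℤ × YoungDiagram)] :
    chargedBox (P + 1) M = chargedBox P M ∪ (chargedBox P M).image (raise P) := by
  ext ⟨n, μ⟩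
  rw [Finset.mem_union]
  constructor
  · intro h
    by_cases h' : (n, μ) ∈ chargedBox P M
    · exact Or.inl h'
    right
    rw [mem_chargedBox] at h h'
    push_cast at h
    refine Finset.mem_image.2 ⟨(n - 1, μ.tailCol), ?_, ?_⟩
    · have h₁ := μ.colLen_tailCol_le
      have h₂ := μ.rowLen_tailCol
      have h₃ := colLen_eq_zero_of_rowLen_eq_zero (μ := μ)
      rw [mem_chargedBox]
      omega
    · have : ((P : ℤ) - (n - 1)).toNat = μ.colLen 0 := by omega
      simp only [raise, this, consCol_tailCol, sub_add_cancel]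
  · rintro (h | h)
    · exact chargedBox_mono (Nat.le_succ P) le_rfl h
    · obtain ⟨⟨n', ν⟩, h, h'⟩ := Finset.mem_image.1 h
      rw [← h', raise, mem_chargedBox, colLen_consCol]
      rw [mem_chargedBox] at h
      dsimp only
      rcases Nat.eq_zero_or_pos ((P : ℤ) - n').toNat with h0 | h0
      · rw [h0, rowLen_consCol_zero]
        omega
      · rw [rowLen_consCol_of_pos h0]
        omega

/-- Reversing the charge and transposing the diagram exchanges the two bounds of a box. -/
def flip (x : ℤ × YoungDiagram) : ℤ × YoungDiagram := (-x.1, x.2.transpose)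

theorem flip_flip (x : ℤ × YoungDiagram) : flip (flip x) = x := by
  simp [flip]

theorem flip_mem_chargedBox {P M : ℕ} {x : ℤ × YoungDiagram} :
    flip x ∈ chargedBox P M ↔ x ∈ chargedBox M P := by
  obtain ⟨n, μ⟩ := x
  rw [flip, mem_chargedBox, mem_chargedBox, colLen_transpose, rowLen_transpose]
  dsimp only
  omega

theorem flip_raise_flip (M : ℕ) (x : ℤ × YoungDiagram) : flip (raise M (flip x)) = lower M x := by
  simp only [flip, raise, lower, consRow, Prod.mk.injEq]
  refine ⟨by ring, ?_⟩
  rw [sub_neg_eq_add, add_comm]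

theorem sum_chargedBox_flip {A : Type*} [AddCommMonoid A] (P M : ℕ) (f : ℤ × YoungDiagram → A) :
    ∑ x ∈ chargedBox P M, f x = ∑ x ∈ chargedBox M P, f (flip x) :=
  Finset.sum_nbij' flip flip (fun _ h => flip_mem_chargedBox.2 h)
    (fun _ h => flip_mem_chargedBox.2 h) (fun _ _ => flip_flip _) (fun _ _ => flip_flip _)
    fun x _ => by rw [flip_flip]

theorem sum_chargedBox_succ_left {A : Type*} [AddCommMonoid A] (P M : ℕ)
    (f : ℤ × YoungDiagram → A) :
    ∑ x ∈ chargedBox (P + 1) M, f x =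
      ∑ x ∈ chargedBox P M, f x + ∑ x ∈ chargedBox P M, f (raise P x) := by
  classical
  rw [chargedBox_succ_left, Finset.sum_union (disjoint_image_raise P M),
    Finset.sum_image (injOn_raise P M)]

theorem sum_chargedBox_succ_right {A : Type*} [AddCommMonoid A] (P M : ℕ)
    (f : ℤ × YoungDiagram → A) :
    ∑ x ∈ chargedBox P (M + 1), f x =
      ∑ x ∈ chargedBox P M, f x + ∑ x ∈ chargedBox P M, f (lower M x) := by
  rw [sum_chargedBox_flip, sum_chargedBox_succ_left, sum_chargedBox_flip P M f,
    sum_chargedBox_flip P M fun x => f (lower M x)]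
  simp only [← flip_raise_flip, flip_flip]

theorem exists_raise_eq {P M : ℕ} {x : ℤ × YoungDiagram} (hx : x ∈ chargedBox (P + 1) M)
    (hx' : x ∉ chargedBox P M) : ∃ w ∈ chargedBox P M, raise P w = x := by
  classical
  rw [chargedBox_succ_left, Finset.mem_union] at hx
  exact Finset.mem_image.1 (hx.resolve_left hx')

theorem exists_lower_eq {P M : ℕ} {x : ℤ × YoungDiagram} (hx : x ∈ chargedBox P (M + 1))
    (hx' : x ∉ chargedBox P M) : ∃ w ∈ chargedBox P M, lower M w = x := by
  obtain ⟨w, hw, h⟩ := exists_raise_eq (flip_mem_chargedBox.2 hx)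
    (fun h => hx' (flip_mem_chargedBox.1 h))
  exact ⟨flip w, flip_mem_chargedBox.2 hw, by rw [← flip_raise_flip, flip_flip, h, flip_flip]⟩

/-! ### Telescoping the box weights of a Young diagram -/

section Weight

variable {N : ℕ} {G H : Type*} [AddCommGroup G] [CommGroup H]

/-- The contribution of the cell `c` to the summand of `χ_ω(x + a)`, for functions `y ω a`
(standing for `Y_ω(x + a)`) with values in any commutative group. -/
def cellWeight (ε m : G) (y : ZMod N → G → H) (ω : ZMod N) (a : G) (c : ℕ × ℕ) : H :=
  (y (ω + 1 - (c.2 : ZMod N)) (a + (c.1 • m - c.2 • (m + ε)) + m + ε) *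
      y (ω - (c.2 : ZMod N)) (a + (c.1 • m - c.2 • (m + ε)) - m)) /
    (y (ω + 1 - (c.2 : ZMod N)) (a + (c.1 • m - c.2 • (m + ε)) + ε) *
      y (ω - (c.2 : ZMod N)) (a + (c.1 • m - c.2 • (m + ε))))

/-- The summand of `χ_ω(x + a)` at `μ` without its couplings. -/
def diagramWeight (ε m : G) (y : ZMod N → G → H) (ω : ZMod N) (a : G) (μ : YoungDiagram) : H :=
  y (ω + 1) (a + ε) * ∏ c ∈ μ.cells, cellWeight ε m y ω a c

/-- Down the first column, the weights telescope in the direction of `m`. -/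
theorem prod_cellWeight_col (ε m : G) (y : ZMod N → G → H) (ω : ZMod N) (a : G) (p : ℕ) :
    ∏ i ∈ Finset.range p, cellWeight ε m y ω a (i, 0) =
      y (ω + 1) (a + p • m + ε) / y (ω + 1) (a + ε) *
        (y ω (a - m) / y ω (a + ((p : ℤ) - 1) • m)) := by
  have h : ∀ i : ℕ, cellWeight ε m y ω a (i, 0) =
      (y (ω + 1) (a + (i + 1) • m + ε) / y (ω + 1) (a + i • m + ε)) /
        (y ω (a + (((i + 1 : ℕ) : ℤ) - 1) • m) / y ω (a + ((i : ℤ) - 1) • m)) := by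
    intro i
    have e₁ : a + i • m + m + ε = a + (i + 1) • m + ε := by module
    have e₂ : a + i • m - m = a + ((i : ℤ) - 1) • m := by module
    have e₃ : a + i • m = a + (((i + 1 : ℕ) : ℤ) - 1) • m := by push_cast; module
    simp only [cellWeight, Nat.cast_zero, sub_zero, zero_smul, e₁, e₂]
    rw [← e₃, div_div_div_eq]
  rw [Finset.prod_congr rfl fun i _ => h i, Finset.prod_div_distrib,
    Finset.prod_range_div (fun i => y (ω + 1) (a + i • m + ε)),
    Finset.prod_range_div (fun i : ℕ => y ω (a + ((i : ℤ) - 1) • m))]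
  have e : a + (((0 : ℕ) : ℤ) - 1) • m = a - m := by push_cast; module
  rw [e, zero_smul, add_zero, div_div_eq_mul_div, mul_div_assoc]

theorem diagramWeight_consCol (ε m : G) (y : ZMod N → G → H) (ω : ZMod N) (a : G) {p : ℕ}
    {μ : YoungDiagram} (hp : μ.colLen 0 ≤ p) :
    diagramWeight ε m y ω a (μ.consCol p) =
      y (ω + 1) (a + p • m + ε) / y ω (a + ((p : ℤ) - 1) • m) *
        diagramWeight ε m y (ω - 1) (a - m - ε) μ := by
  have h : ∀ c : ℕ × ℕ, cellWeight ε m y ω a (c.1, c.2 + 1) =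
      cellWeight ε m y (ω - 1) (a - m - ε) c := by
    intro c
    have e₁ : a + (c.1 • m - (c.2 + 1) • (m + ε)) = a - m - ε + (c.1 • m - c.2 • (m + ε)) := by
      module
    have e₂ : ω + 1 - ((c.2 + 1 : ℕ) : ZMod N) = ω - 1 + 1 - (c.2 : ZMod N) := by push_cast; ring
    have e₃ : ω - ((c.2 + 1 : ℕ) : ZMod N) = ω - 1 - (c.2 : ZMod N) := by push_cast; ring
    simp only [cellWeight, e₁, e₂, e₃]
  rw [diagramWeight, diagramWeight, prod_cells_consCol hp, prod_cellWeight_col,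
    Finset.prod_congr rfl fun c _ => h c, sub_add_cancel, sub_add_cancel, ← mul_assoc,
    ← mul_assoc, mul_div_cancel, ← mul_div_assoc, mul_div_right_comm, mul_assoc]

/-- Along the first row, the weights telescope in the direction of `m + ε`, with `ω` decreasing. -/
theorem prod_cellWeight_row (ε m : G) (y : ZMod N → G → H) (ω : ZMod N) (a : G) (p : ℕ) :
    ∏ j ∈ Finset.range p, cellWeight ε m y ω a (0, j) =
      (y (ω + 1) (a + m + ε) / y (ω + 1) (a + ε)) *
        (y (ω + 1 - (p : ZMod N)) (a - p • (m + ε) + ε) /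
          y (ω + 1 - (p : ZMod N)) (a - p • (m + ε) + m + ε)) := by
  have h : ∀ j : ℕ, cellWeight ε m y ω a (0, j) =
      (y (ω + 1 - ((j + 1 : ℕ) : ZMod N)) (a - (j + 1) • (m + ε) + ε) /
        y (ω + 1 - (j : ZMod N)) (a - j • (m + ε) + ε)) /
      (y (ω + 1 - ((j + 1 : ℕ) : ZMod N)) (a - (j + 1) • (m + ε) + m + ε) /
        y (ω + 1 - (j : ZMod N)) (a - j • (m + ε) + m + ε)) := by
    intro j
    have e₀ : a + (0 • m - j • (m + ε)) = a - j • (m + ε) := by module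
    have e₁ : ω + 1 - ((j + 1 : ℕ) : ZMod N) = ω - (j : ZMod N) := by push_cast; ring
    have e₂ : a - (j + 1) • (m + ε) + ε = a - j • (m + ε) - m := by module
    have e₃ : a - (j + 1) • (m + ε) + m + ε = a - j • (m + ε) := by module
    simp only [cellWeight, e₀, e₁, e₂, e₃]
    rw [div_div_div_eq]
    rw [mul_comm (y (ω + 1 - (j : ZMod N)) _), mul_comm (y (ω + 1 - (j : ZMod N)) _)]
  rw [Finset.prod_congr rfl fun i _ => h i, Finset.prod_div_distrib,
    Finset.prod_range_div (fun j : ℕ => y (ω + 1 - (j : ZMod N)) (a - j • (m + ε) + ε)),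
    Finset.prod_range_div (fun j : ℕ => y (ω + 1 - (j : ZMod N)) (a - j • (m + ε) + m + ε))]
  simp only [Nat.cast_zero, sub_zero, zero_smul]
  rw [div_div_div_eq, div_mul_div_comm]
  rw [mul_comm (y (ω + 1) _), mul_comm (y (ω + 1) _)]

theorem diagramWeight_consRow (ε m : G) (y : ZMod N → G → H) (ω : ZMod N) (a : G) {p : ℕ}
    {μ : YoungDiagram} (hp : μ.rowLen 0 ≤ p) :
    diagramWeight ε m y ω a (μ.consRow p) =
      y (ω + 1 - (p : ZMod N)) (a - p • (m + ε) + ε) /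
          y (ω + 1 - (p : ZMod N)) (a - p • (m + ε) + m + ε) *
        diagramWeight ε m y ω (a + m) μ := by
  have h : ∀ c : ℕ × ℕ, cellWeight ε m y ω a (c.1 + 1, c.2) =
      cellWeight ε m y ω (a + m) c := by
    intro c
    have e₁ : a + ((c.1 + 1) • m - c.2 • (m + ε)) = a + m + (c.1 • m - c.2 • (m + ε)) := by
      module
    simp only [cellWeight, e₁]
  rw [diagramWeight, diagramWeight, prod_cells_consRow hp, prod_cellWeight_row,
    Finset.prod_congr rfl fun c _ => h c, ← mul_assoc, ← mul_assoc, mul_div_cancel]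
  ac_rfl

end Weight

/-! ### The topology of coefficientwise stabilization -/

section Topology

variable {N : ℕ} {R : Type*}

theorem tendsto_nhds_iff_eventually_coeff_eq [Semiring R] {ι : Type*} {l : Filter ι}
    {u : ι → MvPowerSeries (ZMod N) R} {a : MvPowerSeries (ZMod N) R} :
    Tendsto u l (𝓝 a) ↔ ∀ d, ∀ᶠ i in l, MvPowerSeries.coeff d (u i) = MvPowerSeries.coeff d a := by
  let _ : TopologicalSpace R := ⊥
  have : DiscreteTopology R := ⟨rfl⟩
  refine (MvPowerSeries.WithPiTopology.tendsto_iff_coeff_tendsto u l a).trans ?_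
  simp only [nhds_discrete, tendsto_pure]

instance couplingIsTopologicalRing [Ring R] : IsTopologicalRing (MvPowerSeries (ZMod N) R) := by
  let _ : TopologicalSpace R := ⊥
  have : DiscreteTopology R := ⟨rfl⟩
  exact MvPowerSeries.WithPiTopology.instIsTopologicalRing (ZMod N) R

instance couplingRegularSpace : RegularSpace (MvPowerSeries (ZMod N) R) := by
  let _ : TopologicalSpace R := ⊥
  have : DiscreteTopology R := ⟨rfl⟩
  exact inferInstanceAs (RegularSpace ((ZMod N →₀ ℕ) → R))

theorem summable_of_finite_coeff_ne_zero [Semiring R] {ι : Type*}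
    {f : ι → MvPowerSeries (ZMod N) R}
    (hf : ∀ d, {i | MvPowerSeries.coeff d (f i) ≠ 0}.Finite) : Summable f := by
  let S : MvPowerSeries (ZMod N) R :=
    fun d => ∑ i ∈ (hf d).toFinset, MvPowerSeries.coeff d (f i)
  refine ⟨S, ?_⟩
  unfold HasSum
  rw [SummationFilter.unconditional_filter, tendsto_nhds_iff_eventually_coeff_eq]
  intro d
  change ∀ᶠ s in atTop, _ = ∑ i ∈ (hf d).toFinset, MvPowerSeries.coeff d (f i)
  filter_upwards [eventually_ge_atTop (hf d).toFinset] with s hs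
  rw [map_sum]
  refine (Finset.sum_subset hs fun i _ hi => ?_).symm
  simpa using hi

/-- A sequence whose successive terms agree to higher and higher order converges. -/
theorem exists_tendsto_of_coeff_succ_eq [Semiring R] {u : ℕ → MvPowerSeries (ZMod N) R}
    (hu : ∀ k d, d.degree < k → MvPowerSeries.coeff d (u (k + 1)) = MvPowerSeries.coeff d (u k)) :
    ∃ a, Tendsto u atTop (𝓝 a) := by
  refine ⟨fun d => MvPowerSeries.coeff d (u (d.degree + 1)),
    tendsto_nhds_iff_eventually_coeff_eq.2 fun d => ?_⟩
  filter_upwards [eventually_ge_atTop (d.degree + 1)] with k hk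
  induction k, hk using Nat.le_induction with
  | base => rfl
  | succ k hk ih => rw [hu k d hk, ih]

end Topology

/-! ### Matrices of cyclic shifts -/

section ShiftMatrix

variable {N : ℕ} {R : Type*} [CommRing R]

/-- The permutation matrix `∑ e_ω ⊗ e_{ω+k}ᵗ`, the `k`-th power of the cyclic shift. -/
def shiftMatrix (R : Type*) [CommRing R] (k : ZMod N) : Matrix (ZMod N) (ZMod N) R :=
  Matrix.of fun ω ω' => if ω' = ω + k then 1 else 0

theorem shiftMatrix_zero : shiftMatrix R (0 : ZMod N) = 1 := by
  ext ω ω'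
  simp [shiftMatrix, Matrix.one_apply, eq_comm]

theorem shiftMatrix_map {S : Type*} [CommRing S] (g : R →+* S) (k : ZMod N) :
    (shiftMatrix R k).map g = shiftMatrix S k := by
  ext ω ω'
  simp [shiftMatrix, apply_ite g]

theorem cyclicShift_eq (K : Type*) [CommRing K] :
    cyclicShift N K = shiftMatrix (MvPowerSeries (ZMod N) K) 1 := rfl

variable [NeZero N]

theorem shiftMatrix_mul (k l : ZMod N) :
    shiftMatrix R k * shiftMatrix R l = shiftMatrix R (k + l) := by
  ext ω ω'
  rw [Matrix.mul_apply, Finset.sum_eq_single (ω + k)]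
  · simp [shiftMatrix, add_assoc]
  · intro j _ hj
    simp [shiftMatrix, hj]
  · simp

theorem shiftMatrix_mul_diagonal (k : ZMod N) (b : ZMod N → R) :
    shiftMatrix R k * Matrix.diagonal b =
      Matrix.diagonal (fun ω => b (ω + k)) * shiftMatrix R k := by
  ext ω ω'
  simp only [shiftMatrix, Matrix.mul_diagonal, Matrix.diagonal_mul, Matrix.of_apply]
  split_ifs with h
  · rw [h, mul_comm]
  · simp

theorem diagonal_mul_shiftMatrix_mul (a b : ZMod N → R) (k l : ZMod N) :
    Matrix.diagonal a * shiftMatrix R k * (Matrix.diagonal b * shiftMatrix R l) =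
      Matrix.diagonal (fun ω => a ω * b (ω + k)) * shiftMatrix R (k + l) := by
  rw [mul_assoc, ← mul_assoc (shiftMatrix R k), shiftMatrix_mul_diagonal, mul_assoc,
    shiftMatrix_mul, ← mul_assoc, Matrix.diagonal_mul_diagonal]

theorem rightOrderedProd_diagonal_mul_shiftMatrix (b : ℕ → ZMod N → R) (n : ℕ) :
    rightOrderedProd (fun k => Matrix.diagonal (b k) * shiftMatrix R (-1)) n =
      Matrix.diagonal (fun ω => ∏ k ∈ Finset.range n, b k (ω - (k : ZMod N))) *
        shiftMatrix R (-(n : ZMod N)) := by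
  induction n with
  | zero => simp [rightOrderedProd, shiftMatrix_zero]
  | succ n ih =>
    rw [rightOrderedProd, ih, diagonal_mul_shiftMatrix_mul]
    simp only [Finset.prod_range_succ, ← sub_eq_add_neg, Nat.cast_succ, neg_add]

theorem rightOrderedProd_diagonal (b : ℕ → ZMod N → R) (n : ℕ) :
    rightOrderedProd (fun k => Matrix.diagonal (b k)) n =
      Matrix.diagonal (fun ω => ∏ k ∈ Finset.range n, b k ω) := by
  induction n with
  | zero => simp [rightOrderedProd]
  | succ n ih =>
    rw [rightOrderedProd, ih, Matrix.diagonal_mul_diagonal]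
    simp only [Finset.prod_range_succ]

theorem rightOrderedProd_const {A : Type*} [Monoid A] (x : A) (n : ℕ) :
    rightOrderedProd (fun _ => x) n = x ^ n := by
  induction n with
  | zero => rw [rightOrderedProd, pow_zero]
  | succ n ih => rw [rightOrderedProd, ih, pow_succ]

variable (K : Type*) [CommRing K]

theorem cyclicShift_inv :
    (cyclicShift N K)⁻¹ = shiftMatrix (MvPowerSeries (ZMod N) K) (-1) := by
  refine Matrix.inv_eq_right_inv ?_
  rw [cyclicShift_eq, shiftMatrix_mul, add_neg_cancel, shiftMatrix_zero]

theorem cyclicShift_pow (n : ℕ) :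
    cyclicShift N K ^ n = shiftMatrix (MvPowerSeries (ZMod N) K) (n : ZMod N) := by
  induction n with
  | zero => simp [shiftMatrix_zero]
  | succ n ih => rw [pow_succ, ih, cyclicShift_eq, shiftMatrix_mul, Nat.cast_succ]

theorem cyclicShift_zpow (n : ℤ) :
    cyclicShift N K ^ n = shiftMatrix (MvPowerSeries (ZMod N) K) (n : ZMod N) := by
  rcases n with n | n
  · simp [cyclicShift_pow]
  · rw [zpow_negSucc, cyclicShift_pow]
    refine Matrix.inv_eq_right_inv ?_
    rw [shiftMatrix_mul, Int.cast_negSucc, add_neg_cancel, shiftMatrix_zero]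

theorem couplingMatrix_mul_cyclicShift_inv_pow (n : ℕ) :
    (couplingMatrix N K * (cyclicShift N K)⁻¹) ^ n =
      Matrix.diagonal (fun ω => ∏ k ∈ Finset.range n, MvPowerSeries.X (ω - (k : ZMod N))) *
        shiftMatrix (MvPowerSeries (ZMod N) K) (-(n : ZMod N)) := by
  rw [← rightOrderedProd_const, cyclicShift_inv, couplingMatrix,
    rightOrderedProd_diagonal_mul_shiftMatrix fun _ => _]

end ShiftMatrix

/-! ### The coupling weight of a charge -/

section CouplingWeight

variable {N : ℕ} {A : Type*} [CommMonoid A]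

/-- The diagonal entries of `D_n`, as monomials in commuting variables `x ω`. -/
def couplingWeight (x : ZMod N → A) : ℤ → ZMod N → A
  | Int.ofNat n => fun ω => ∏ k ∈ Finset.range n, x (ω - (k : ZMod N)) ^ (n - k)
  | Int.negSucc n => fun ω =>
      ∏ k ∈ Finset.range n, ∏ i ∈ Finset.range (k + 1), x (ω + ((i + 1 : ℕ) : ZMod N))

theorem prod_range_add_sub (x : ZMod N → A) (ω : ZMod N) (k : ℕ) :
    ∏ i ∈ Finset.range k, x (ω + (k : ZMod N) - (i : ZMod N)) =
      ∏ i ∈ Finset.range k, x (ω + ((i + 1 : ℕ) : ZMod N)) := by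
  rw [← Finset.prod_range_reflect]
  refine Finset.prod_congr rfl fun i hi => ?_
  have hi := Finset.mem_range.1 hi
  rw [add_sub_assoc, ← Nat.cast_sub (by omega)]
  congr 3
  omega

theorem couplingFactor_eq [NeZero N] (K : Type*) [CommRing K] (n : ℤ) :
    couplingFactor N K n = Matrix.diagonal (couplingWeight MvPowerSeries.X n) := by
  rcases n with n | n
  · simp only [couplingFactor, cyclicShift_inv, couplingMatrix, Matrix.diagonal_pow,
      rightOrderedProd_diagonal_mul_shiftMatrix, cyclicShift_pow]
    rw [mul_assoc, shiftMatrix_mul, neg_add_cancel, shiftMatrix_zero, mul_one]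
    rfl
  · have h : ∀ k : ℕ, cyclicShift N K ^ (k + 1) *
        (couplingMatrix N K * (cyclicShift N K)⁻¹) ^ (k + 1) = Matrix.diagonal fun ω =>
          ∏ i ∈ Finset.range (k + 1), MvPowerSeries.X (ω + ((i + 1 : ℕ) : ZMod N)) := by
      intro k
      rw [couplingMatrix_mul_cyclicShift_inv_pow, cyclicShift_pow, ← mul_assoc,
        shiftMatrix_mul_diagonal, mul_assoc, shiftMatrix_mul, add_neg_cancel, shiftMatrix_zero,
        mul_one]
      simp only [prod_range_add_sub]
    simp only [couplingFactor, h, rightOrderedProd_diagonal]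
    rfl

theorem couplingWeight_zero (x : ZMod N → A) (ω : ZMod N) : couplingWeight x 0 ω = 1 := rfl

theorem couplingWeight_succ (x : ZMod N → A) (n : ℕ) (ω : ZMod N) :
    couplingWeight x (n + 1) ω =
      couplingWeight x n ω * ∏ j ∈ Finset.range (n + 1), x (ω - (j : ZMod N)) := by
  change ∏ k ∈ Finset.range (n + 1), x (ω - (k : ZMod N)) ^ (n + 1 - k) =
    (∏ k ∈ Finset.range n, x (ω - (k : ZMod N)) ^ (n - k)) * _
  have h : ∏ k ∈ Finset.range n, x (ω - (k : ZMod N)) ^ (n - k) =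
      ∏ k ∈ Finset.range (n + 1), x (ω - (k : ZMod N)) ^ (n - k) := by
    rw [Finset.prod_range_succ, Nat.sub_self, pow_zero, mul_one]
  rw [h, ← Finset.prod_mul_distrib]
  refine Finset.prod_congr rfl fun k hk => ?_
  have hk := Finset.mem_range.1 hk
  rw [← pow_succ]
  congr 1
  omega

theorem couplingWeight_neg_succ (x : ZMod N → A) (n : ℕ) (ω : ZMod N) :
    couplingWeight x (-(n : ℤ) - 1) ω =
      couplingWeight x (-(n : ℤ)) ω * ∏ i ∈ Finset.range n, x (ω + ((i + 1 : ℕ) : ZMod N)) := by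
  rcases n with _ | n
  · rw [Finset.prod_range_zero, mul_one]
    rfl
  · rw [show (-((n + 1 : ℕ) : ℤ) - 1) = Int.negSucc (n + 1) by omega,
      show (-((n + 1 : ℕ) : ℤ)) = Int.negSucc n by omega]
    simp only [couplingWeight]
    rw [Finset.prod_range_succ]

theorem couplingWeight_succ' (x : ZMod N → A) (n : ℕ) (ω : ZMod N) :
    couplingWeight x (n + 1) ω = x ω ^ (n + 1) * couplingWeight x n (ω - 1) := by
  change ∏ k ∈ Finset.range (n + 1), x (ω - (k : ZMod N)) ^ (n + 1 - k) =
    _ * ∏ k ∈ Finset.range n, x (ω - 1 - (k : ZMod N)) ^ (n - k)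
  rw [Finset.prod_range_succ', mul_comm]
  simp only [Nat.cast_zero, sub_zero, Nat.sub_zero, Nat.cast_succ, Nat.add_sub_add_right, sub_sub,
    add_comm (1 : ZMod N)]

theorem couplingWeight_neg_succ' (x : ZMod N → A) (n : ℕ) (ω : ZMod N) :
    couplingWeight x (-(n : ℤ) - 1) (ω - 1) = x ω ^ n * couplingWeight x (-(n : ℤ)) ω := by
  induction n with
  | zero =>
    rw [pow_zero, one_mul]
    rfl
  | succ n ih =>
    have e : (-((n + 1 : ℕ) : ℤ)) = -(n : ℤ) - 1 := by omega
    rw [couplingWeight_neg_succ, e, ih, couplingWeight_neg_succ, Finset.prod_range_succ', pow_succ]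
    have h : ∀ i : ℕ, ω - 1 + ((i + 1 + 1 : ℕ) : ZMod N) = ω + ((i + 1 : ℕ) : ZMod N) := by
      intro i
      push_cast
      ring
    have h₀ : ω - 1 + ((0 + 1 : ℕ) : ZMod N) = ω := by simp
    simp only [h, h₀]
    ac_rfl

/-- The passage from `D_n` to `D_{n+1}` that accompanies the prepending of a column of length
`P - n`. -/
theorem couplingWeight_raise (x : ZMod N → A) (P : ℕ) {n : ℤ} (hn : n ≤ P) (ω : ZMod N) :
    x ω ^ (P + 1) * couplingWeight x n (ω - 1) =
      x ω ^ (P - n).toNat * couplingWeight x (n + 1) ω := by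
  rcases le_or_gt 0 n with h | h
  · lift n to ℕ using h
    rw [couplingWeight_succ', ← mul_assoc, ← pow_add]
    congr 2
    omega
  · obtain ⟨k, hk⟩ := Int.eq_ofNat_of_zero_le (show 0 ≤ -n - 1 by omega)
    obtain rfl : n = -(k : ℤ) - 1 := by omega
    rw [couplingWeight_neg_succ', sub_add_cancel, ← mul_assoc, ← pow_add]
    congr 2
    omega

/-- The passage from `D_n` to `D_{n-1}` that accompanies the prepending of a row of length
`n + M`. -/
theorem couplingWeight_lower (x : ZMod N → A) (M : ℕ) {n : ℤ} (hn : 0 ≤ n + M) (ω : ZMod N) :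
    couplingWeight x n ω * ∏ i ∈ Finset.range M, x (ω - (n : ZMod N) - (i : ZMod N)) =
      (∏ j ∈ Finset.range (n + M).toNat, x (ω - (j : ZMod N))) * couplingWeight x (n - 1) ω := by
  rcases lt_or_ge 0 n with h | h
  · obtain ⟨k, hk⟩ := Int.eq_ofNat_of_zero_le (show 0 ≤ n - 1 by omega)
    obtain rfl : n = (k : ℤ) + 1 := by omega
    have e : ((k : ℤ) + 1 + M).toNat = k + 1 + M := by omega
    rw [couplingWeight_succ, add_sub_cancel_right, e, Finset.prod_range_add _ (k + 1) M]
    simp only [sub_sub, Nat.cast_add, Nat.cast_one, Int.cast_add, Int.cast_one, Int.cast_natCast]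
    rw [mul_assoc, mul_comm]
  · obtain ⟨k, hk⟩ := Int.eq_ofNat_of_zero_le (show 0 ≤ -n by omega)
    obtain ⟨r, hr⟩ := Int.eq_ofNat_of_zero_le hn
    obtain rfl : n = -(k : ℤ) := by omega
    obtain rfl : M = k + r := by omega
    have e : (-(k : ℤ) + ((k + r : ℕ) : ℤ)).toNat = r := by omega
    have h : ∀ i : ℕ, ω + (k : ZMod N) - ((k + i : ℕ) : ZMod N) = ω - (i : ZMod N) := by
      intro i
      push_cast
      ring
    rw [couplingWeight_neg_succ, e, Finset.prod_range_add]
    simp only [Int.cast_neg, Int.cast_natCast, sub_neg_eq_add, prod_range_add_sub, h]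
    ac_rfl

end CouplingWeight

noncomputable section

/-! ### The algebra of matrix difference operators -/

section Algebra

variable {N : ℕ} {G K : Type*} [AddCommGroup G] [CommRing K]
  [MulSemiringAction (Multiplicative G) K]

theorem coeff_translate (a : G) (f : MvPowerSeries (ZMod N) K) (d : ZMod N →₀ ℕ) :
    MvPowerSeries.coeff d (translate N a f) =
      Multiplicative.ofAdd a • MvPowerSeries.coeff d f := rfl

theorem translate_zero (f : MvPowerSeries (ZMod N) K) : translate N (0 : G) f = f := by
  ext d
  rw [coeff_translate, ofAdd_zero, one_smul]

theorem translate_translate (a b : G) (f : MvPowerSeries (ZMod N) K) :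
    translate N a (translate N b f) = translate N (b + a) f := by
  ext d
  rw [coeff_translate, coeff_translate, coeff_translate, smul_smul, ← ofAdd_add, add_comm]

theorem translate_X (a : G) (ω : ZMod N) :
    translate N a (MvPowerSeries.X ω : MvPowerSeries (ZMod N) K) = MvPowerSeries.X ω :=
  MvPowerSeries.map_X _ _

theorem continuous_translate (a : G) : Continuous (translate (K := K) N a) := by
  refine continuous_iff_continuousAt.2 fun f => tendsto_nhds_iff_eventually_coeff_eq.2 fun d => ?_
  filter_upwards [tendsto_nhds_iff_eventually_coeff_eq.1 (tendsto_id (x := 𝓝 f)) d] with g hg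
  rw [coeff_translate, coeff_translate, ← hg, id]

variable [NeZero N]

theorem coeff_ofMatrix (A : Matrix (ZMod N) (ZMod N) (MvPowerSeries (ZMod N) K))
    (d : ZMod N →₀ ℕ) :
    MvPowerSeries.coeff d (ofMatrix G A) =
      SkewMonoidAlgebra.single 1 (A.map fun f => MvPowerSeries.coeff d f) := rfl

theorem ofMatrix_add (A B : Matrix (ZMod N) (ZMod N) (MvPowerSeries (ZMod N) K)) :
    ofMatrix G (A + B) = ofMatrix G A + ofMatrix G B := by
  ext1 d
  rw [map_add, coeff_ofMatrix, coeff_ofMatrix, coeff_ofMatrix, ← SkewMonoidAlgebra.single_add]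
  congr 1

theorem ofMatrix_mul (A B : Matrix (ZMod N) (ZMod N) (MvPowerSeries (ZMod N) K)) :
    ofMatrix G (A * B) = ofMatrix G A * ofMatrix G B := by
  ext1 d
  rw [coeff_ofMatrix, MvPowerSeries.coeff_mul]
  simp only [coeff_ofMatrix, SkewMonoidAlgebra.single_mul_single, one_smul, mul_one]
  let φ : Matrix (ZMod N) (ZMod N) K →+ SkewMonoidAlgebra (Matrix (ZMod N) (ZMod N) K)
      (Multiplicative (ℤ × G)) :=
    ⟨⟨SkewMonoidAlgebra.single 1, SkewMonoidAlgebra.single_zero 1⟩, SkewMonoidAlgebra.single_add 1⟩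
  refine Eq.trans (congrArg φ ?_) (map_sum φ _ _)
  ext i j
  rw [Matrix.sum_apply]
  simp only [Matrix.map_apply, Matrix.mul_apply, map_sum, MvPowerSeries.coeff_mul]
  exact Finset.sum_comm

theorem ofMatrix_mul_zPow (A : Matrix (ZMod N) (ZMod N) (MvPowerSeries (ZMod N) K)) (k : ℤ) :
    ofMatrix G A * zPow N G K k = zPow N G K k * ofMatrix G A := by
  ext1 d
  rw [zPow, MvPowerSeries.coeff_mul_C, MvPowerSeries.coeff_C_mul, coeff_ofMatrix,
    SkewMonoidAlgebra.single_mul_single, SkewMonoidAlgebra.single_mul_single, one_smul, mul_one,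
    one_mul, one_mul, mul_one]
  congr 1
  ext i j
  exact (one_smul (Multiplicative G) _).symm

theorem shiftOp_mul_zPow (a : G) (k : ℤ) :
    shiftOp N K a * zPow N G K k = zPow N G K k * shiftOp N K a := by
  rw [shiftOp, zPow, ← map_mul, ← map_mul, SkewMonoidAlgebra.single_mul_single,
    SkewMonoidAlgebra.single_mul_single, smul_one, smul_one, mul_comm (Multiplicative.ofAdd _)]

theorem zPow_add (k l : ℤ) : zPow N G K (k + l) = zPow N G K k * zPow N G K l := by
  rw [zPow, zPow, zPow, ← map_mul, SkewMonoidAlgebra.single_mul_single, smul_one, mul_one,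
    ← ofAdd_add, Prod.mk_add_mk, add_zero]

theorem shiftOp_add (a b : G) : shiftOp N K (a + b) = shiftOp N K a * shiftOp N K b := by
  rw [shiftOp, shiftOp, shiftOp, ← map_mul, SkewMonoidAlgebra.single_mul_single, smul_one, mul_one,
    ← ofAdd_add, Prod.mk_add_mk, add_zero]

theorem shiftOp_mul_ofMatrix (a : G) (A : Matrix (ZMod N) (ZMod N) (MvPowerSeries (ZMod N) K)) :
    shiftOp N K a * ofMatrix G A = ofMatrix G (A.map (translate N a)) * shiftOp N K a := by
  ext1 d
  rw [shiftOp, MvPowerSeries.coeff_mul_C, MvPowerSeries.coeff_C_mul, coeff_ofMatrix,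
    coeff_ofMatrix, SkewMonoidAlgebra.single_mul_single, SkewMonoidAlgebra.single_mul_single,
    smul_one, mul_one, one_mul, one_mul, mul_one]
  rfl

theorem zPow_zero : zPow N G K 0 = 1 := by
  rw [zPow, ← Prod.zero_eq_mk, ofAdd_zero, SkewMonoidAlgebra.single_one_one, map_one]

theorem shiftOp_zero : shiftOp N K (0 : G) = 1 := by
  rw [shiftOp, ← Prod.zero_eq_mk, ofAdd_zero, SkewMonoidAlgebra.single_one_one, map_one]

/-- The operator `z^{n/N} diag(a_ω) C^{-n} e^{-nε∂ₓ}`.  Every operator in the factorization is a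
combination of these. -/
def monomialOp (ε : G) (n : ℤ) (a : ZMod N → MvPowerSeries (ZMod N) K) : DiffOp N G K :=
  zPow N G K n * ofMatrix G (Matrix.diagonal a * shiftMatrix _ (-(n : ZMod N))) *
    shiftOp N K (-(n • ε))

theorem monomialOp_zero (ε : G) (a : ZMod N → MvPowerSeries (ZMod N) K) :
    monomialOp ε 0 a = ofMatrix G (Matrix.diagonal a) := by
  rw [monomialOp, zPow_zero, zero_smul, neg_zero, shiftOp_zero, Int.cast_zero, neg_zero,
    shiftMatrix_zero, mul_one, mul_one, one_mul]

theorem map_diagonal_mul_shiftMatrix (a : G) (b : ZMod N → MvPowerSeries (ZMod N) K)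
    (k : ZMod N) :
    (Matrix.diagonal b * shiftMatrix _ k).map (translate N a) =
      Matrix.diagonal (fun ω => translate N a (b ω)) * shiftMatrix _ k := by
  rw [Matrix.map_mul, shiftMatrix_map, Matrix.diagonal_map (map_zero _)]

theorem monomialOp_mul (ε : G) (n k : ℤ) (a b : ZMod N → MvPowerSeries (ZMod N) K) :
    monomialOp ε n a * monomialOp ε k b =
      monomialOp ε (n + k) fun ω => a ω * translate N (-(n • ε)) (b (ω - (n : ZMod N))) := by
  have e₁ : -((n + k) • ε) = -(n • ε) + -(k • ε) := by module
  have e₂ : -((n + k : ℤ) : ZMod N) = -(n : ZMod N) + -(k : ZMod N) := by push_cast; ring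
  simp only [monomialOp, e₁, e₂, zPow_add, shiftOp_add, sub_eq_add_neg]
  rw [← diagonal_mul_shiftMatrix_mul a fun ω => translate N (-(n • ε)) (b ω),
    ← map_diagonal_mul_shiftMatrix]
  generalize Matrix.diagonal a * shiftMatrix _ (-(n : ZMod N)) = A
  generalize Matrix.diagonal b * shiftMatrix _ (-(k : ZMod N)) = B
  rw [ofMatrix_mul]
  simp only [mul_assoc]
  rw [← mul_assoc (shiftOp N K _) (zPow N G K k), shiftOp_mul_zPow, mul_assoc,
    ← mul_assoc (shiftOp N K (-(n • ε))) (ofMatrix G _), shiftOp_mul_ofMatrix,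
    ← mul_assoc (ofMatrix G _) (zPow N G K k), ofMatrix_mul_zPow]
  simp only [mul_assoc]

theorem monomialOp_add (ε : G) (n : ℤ) (a b : ZMod N → MvPowerSeries (ZMod N) K) :
    monomialOp ε n (a + b) = monomialOp ε n a + monomialOp ε n b := by
  have h : Matrix.diagonal (a + b) = Matrix.diagonal a + Matrix.diagonal b :=
    (Matrix.diagonal_add a b).symm
  rw [monomialOp, h, add_mul, ofMatrix_add, mul_add, add_mul]
  rfl

theorem coeff_monomialOp_eq_zero (ε : G) (n : ℤ) {a : ZMod N → MvPowerSeries (ZMod N) K}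
    {d : ZMod N →₀ ℕ} (ha : ∀ ω, MvPowerSeries.coeff d (a ω) = 0) :
    MvPowerSeries.coeff d (monomialOp ε n a) = 0 := by
  have h : ((Matrix.diagonal a * shiftMatrix (MvPowerSeries (ZMod N) K) (-(n : ZMod N))).map
      fun f => MvPowerSeries.coeff d f) = 0 := by
    ext i j
    rw [Matrix.map_apply, Matrix.diagonal_mul, shiftMatrix, Matrix.of_apply, mul_ite, mul_one,
      mul_zero, apply_ite (MvPowerSeries.coeff d), ha, map_zero, ite_self, Matrix.zero_apply]
  rw [monomialOp, shiftOp, zPow, MvPowerSeries.coeff_mul_C, MvPowerSeries.coeff_C_mul,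
    coeff_ofMatrix, h, SkewMonoidAlgebra.single_zero, mul_zero, zero_mul]

theorem coeff_eq_zero_of_coeff_monomialOp_zero {ε : G} {a : ZMod N → MvPowerSeries (ZMod N) K}
    {d : ZMod N →₀ ℕ} (h : MvPowerSeries.coeff d (monomialOp ε 0 a) = 0) (ω : ZMod N) :
    MvPowerSeries.coeff d (a ω) = 0 := by
  rw [monomialOp_zero, coeff_ofMatrix, SkewMonoidAlgebra.single_eq_zero] at h
  simpa using congrFun (congrFun h ω) ω

theorem le_order_monomialOp (ε : G) (n : ℤ) {a : ZMod N → MvPowerSeries (ZMod N) K} {k : ℕ}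
    (ha : ∀ ω, (k : ℕ∞) ≤ (a ω).order) : (k : ℕ∞) ≤ (monomialOp ε n a).order :=
  MvPowerSeries.le_order fun _ hd => coeff_monomialOp_eq_zero ε n fun ω =>
    MvPowerSeries.coeff_of_lt_order (hd.trans_le (ha ω))

theorem continuous_monomialOp (ε : G) (n : ℤ) :
    Continuous (monomialOp (N := N) (K := K) ε n) := by
  refine continuous_iff_continuousAt.2 fun a => ?_
  refine tendsto_nhds_iff_eventually_coeff_eq.2 fun d => ?_
  have h : ∀ ω, ∀ᶠ b in 𝓝 a, MvPowerSeries.coeff d (b ω) = MvPowerSeries.coeff d (a ω) :=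
    fun ω => tendsto_nhds_iff_eventually_coeff_eq.1 ((continuous_apply ω).tendsto a) d
  filter_upwards [eventually_all.2 h] with b hb
  have := coeff_monomialOp_eq_zero (d := d) ε n (a := b - a) fun ω => by
    rw [Pi.sub_apply, map_sub, hb, sub_self]
  rw [← sub_add_cancel b a, monomialOp_add, map_add, this, zero_add]

end Algebra

/-! ### The factors and the summands in terms of `Y` -/

section Terms

variable {N : ℕ} {G K : Type*} [AddCommGroup G] [CommRing K]
  [MulSemiringAction (Multiplicative G) K]

variable (K) in
/-- The translation `f(x) ↦ f(x + a)` of units. -/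
def translateUnits (N : ℕ) (a : G) : (MvPowerSeries (ZMod N) K)ˣ →* (MvPowerSeries (ZMod N) K)ˣ :=
  Units.map (translate (K := K) N a)

theorem translate_val (b : G) (u : (MvPowerSeries (ZMod N) K)ˣ) :
    translate N b u.val = (translateUnits K N b u).val := rfl

/-- The units `Y_ω(x + a)`. -/
def unitAt (U : ZMod N → (MvPowerSeries (ZMod N) K)ˣ) (ω : ZMod N) (a : G) :
    (MvPowerSeries (ZMod N) K)ˣ :=
  translateUnits K N a (U ω)

theorem val_unitAt (U : ZMod N → (MvPowerSeries (ZMod N) K)ˣ) (ω : ZMod N) (a : G) :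
    (unitAt U ω a).val = translate N a (U ω).val := rfl

theorem map_unitAt (U : ZMod N → (MvPowerSeries (ZMod N) K)ˣ) (ω : ZMod N) (a b : G) :
    translateUnits K N b (unitAt U ω a) = unitAt U ω (a + b) :=
  Units.ext (translate_translate b a _)

theorem map_diagramWeight (ε m : G) (U : ZMod N → (MvPowerSeries (ZMod N) K)ˣ) (ω : ZMod N)
    (a b : G) (μ : YoungDiagram) :
    translateUnits K N b
      (diagramWeight ε m (unitAt U) ω a μ) =
        diagramWeight ε m (unitAt U) ω (a + b) μ := by
  have e₁ : ∀ v : G, a + v + m + ε + b = a + b + v + m + ε := fun v => by abel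
  have e₂ : ∀ v : G, a + v - m + b = a + b + v - m := fun v => by abel
  have e₃ : ∀ v : G, a + v + ε + b = a + b + v + ε := fun v => by abel
  have e₄ : ∀ v : G, a + v + b = a + b + v := fun v => by abel
  simp only [diagramWeight, cellWeight, map_mul, map_prod, map_div, map_unitAt, e₁, e₂, e₃,
    e₄]

theorem qqTerm_eq (ε m : G) (U : ZMod N → (MvPowerSeries (ZMod N) K)ˣ) (ω : ZMod N)
    (μ : YoungDiagram) :
    qqTerm ε m (fun ω => (U ω : MvPowerSeries (ZMod N) K)) ω μ =
      (∏ c ∈ μ.cells, MvPowerSeries.X (ω - (c.2 : ZMod N))) *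
        (diagramWeight ε m (unitAt U) ω 0 μ).val := by
  rw [qqTerm, prod_cells_snd μ fun j => (MvPowerSeries.X (ω - (j : ZMod N)) :
    MvPowerSeries (ZMod N) K)]
  simp only [diagramWeight, cellWeight, zero_add, Units.val_mul, Units.coe_prod,
    div_eq_mul_inv, ← val_unitAt]
  simp only [← Units.val_mul, Ring.inverse_unit]
  ring

/-- The diagonal entries of the summand of `(-1)ⁿ z^{n/N} χ̂(x + n m) D_n C^{-n} e^{-nε∂ₓ}` at the
Young diagram `μ`, without the sign. -/
def chargedCoeff (ε m : G) (U : ZMod N → (MvPowerSeries (ZMod N) K)ˣ) (x : ℤ × YoungDiagram)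
    (ω : ZMod N) : MvPowerSeries (ZMod N) K :=
  (∏ c ∈ x.2.cells, MvPowerSeries.X (ω - (c.2 : ZMod N))) *
    (diagramWeight ε m (unitAt U) ω (x.1 • m) x.2).val *
    couplingWeight MvPowerSeries.X x.1 ω

theorem translate_prod_X (a : G) {ι : Type*} (s : Finset ι) (f : ι → ZMod N) :
    translate N a (∏ i ∈ s, MvPowerSeries.X (f i) : MvPowerSeries (ZMod N) K) =
      ∏ i ∈ s, MvPowerSeries.X (f i) := by
  simp only [map_prod, translate_X]

theorem translate_couplingWeight (a : G) (n : ℤ) (ω : ZMod N) :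
    translate N a (couplingWeight MvPowerSeries.X n ω : MvPowerSeries (ZMod N) K) =
      couplingWeight MvPowerSeries.X n ω := by
  rcases n with n | n <;> simp only [couplingWeight, map_prod, map_pow, translate_X]

theorem chargedCoeff_eq (ε m : G) (U : ZMod N → (MvPowerSeries (ZMod N) K)ˣ)
    (x : ℤ × YoungDiagram) (ω : ZMod N) :
    chargedCoeff ε m U x ω =
      translate N (x.1 • m) (qqTerm ε m (fun ω => (U ω : MvPowerSeries (ZMod N) K)) ω x.2) *
        couplingWeight MvPowerSeries.X x.1 ω := by
  rw [qqTerm_eq, map_mul, translate_prod_X, translate_val, map_diagramWeight, zero_add]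
  rfl

theorem translate_chargedCoeff (ε m : G) (U : ZMod N → (MvPowerSeries (ZMod N) K)ˣ)
    (x : ℤ × YoungDiagram) (ω : ZMod N) (a : G) :
    translate N a (chargedCoeff ε m U x ω) =
      (∏ c ∈ x.2.cells, MvPowerSeries.X (ω - (c.2 : ZMod N))) *
        (diagramWeight ε m (unitAt U) ω (x.1 • m + a) x.2).val *
        couplingWeight MvPowerSeries.X x.1 ω := by
  rw [chargedCoeff, map_mul, map_mul, translate_prod_X, translate_val, map_diagramWeight,
    translate_couplingWeight]

/-- The diagonal entries of the operator subtracted from `1` in the left factor of index `n`. -/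
def leftCoeff (ε m : G) (U : ZMod N → (MvPowerSeries (ZMod N) K)ˣ) (n : ℕ) (ω : ZMod N) :
    MvPowerSeries (ZMod N) K :=
  MvPowerSeries.X ω ^ n *
    (unitAt U (ω + 1) (n • m + ε) / unitAt U ω (((n : ℤ) - 1) • m)).val

/-- The diagonal entries of the operator subtracted from `1` in the right factor of index `n`. -/
def rightCoeff (ε m : G) (U : ZMod N → (MvPowerSeries (ZMod N) K)ˣ) (n : ℕ) (ω : ZMod N) :
    MvPowerSeries (ZMod N) K :=
  (∏ i ∈ Finset.range n, MvPowerSeries.X (ω - (i : ZMod N))) *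
    (unitAt U (ω - n + 1) (-((n + 1) • m) - n • ε + ε) /
      unitAt U (ω - n + 1) (-(n • m) - n • ε + ε)).val

/-- Prepending a column to a diagram amounts to multiplying by an entry of a left factor. -/
theorem chargedCoeff_raise (ε m : G) (U : ZMod N → (MvPowerSeries (ZMod N) K)ˣ) {P M : ℕ}
    {x : ℤ × YoungDiagram} (hx : x ∈ chargedBox P M) (ω : ZMod N) :
    chargedCoeff ε m U (raise P x) ω =
      leftCoeff ε m U (P + 1) ω * translate N (-ε) (chargedCoeff ε m U x (ω - 1)) := by
  obtain ⟨n, μ⟩ := x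
  rw [mem_chargedBox] at hx
  have hp : μ.colLen 0 ≤ ((P : ℤ) - n).toNat := by omega
  have hpn : (((P : ℤ) - n).toNat : ℤ) = P - n := by omega
  have e₁ : (n + 1) • m + ((P : ℤ) - n).toNat • m + ε = (P + 1) • m + ε := by
    rw [← natCast_zsmul _ (((P : ℤ) - n).toNat), hpn]
    module
  have e₂ : (n + 1) • m + ((((P : ℤ) - n).toNat : ℤ) - 1) • m = (((P + 1 : ℕ) : ℤ) - 1) • m := by
    rw [hpn]
    push_cast
    module
  have e₃ : (n + 1) • m - m - ε = n • m + -ε := by module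
  have e₄ : ∀ j : ℕ, ω - ((j + 1 : ℕ) : ZMod N) = ω - 1 - (j : ZMod N) := fun j => by
    push_cast
    ring
  have hD := couplingWeight_raise (MvPowerSeries.X : ZMod N → MvPowerSeries (ZMod N) K) P
    (show n ≤ P by omega) ω
  rw [translate_chargedCoeff, chargedCoeff, raise, diagramWeight_consCol ε m _ _ _ hp,
    prod_cells_consCol hp, leftCoeff]
  simp only [e₁, e₂, e₃, e₄, Nat.cast_zero, sub_zero, Finset.prod_const, Finset.card_range,
    Units.val_mul]
  linear_combination (-(∏ c ∈ μ.cells, MvPowerSeries.X (ω - 1 - (c.2 : ZMod N))) *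
    (unitAt U (ω + 1) ((P + 1) • m + ε) / unitAt U ω (((P + 1 : ℕ) - 1 : ℤ) • m)).val *
    (diagramWeight ε m (unitAt U) (ω - 1) (n • m + -ε) μ).val) * hD

/-- Prepending a row to a diagram amounts to multiplying by an entry of a right factor. -/
theorem chargedCoeff_lower (ε m : G) (U : ZMod N → (MvPowerSeries (ZMod N) K)ˣ) {P M : ℕ}
    {x : ℤ × YoungDiagram} (hx : x ∈ chargedBox P M) (ω : ZMod N) :
    chargedCoeff ε m U (lower M x) ω =
      chargedCoeff ε m U x ω *
        translate N (-(x.1 • ε)) (rightCoeff ε m U M (ω - (x.1 : ZMod N))) := by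
  obtain ⟨n, μ⟩ := x
  rw [mem_chargedBox] at hx
  have hp : μ.rowLen 0 ≤ (n + M).toNat := by omega
  have hpn : ((n + M).toNat : ℤ) = n + M := by omega
  have hpω : ((n + M).toNat : ZMod N) = n + M := by
    rw [← Int.cast_natCast, hpn]
    push_cast
    rfl
  have e₁ : (n - 1) • m - (n + M).toNat • (m + ε) + ε =
      -((M + 1) • m) - M • ε + ε + -(n • ε) := by
    rw [← natCast_zsmul _ (n + M).toNat, hpn]
    module
  have e₂ : (n - 1) • m - (n + M).toNat • (m + ε) + m + ε =
      -(M • m) - M • ε + ε + -(n • ε) := by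
    rw [← natCast_zsmul _ (n + M).toNat, hpn]
    module
  have e₃ : (n - 1) • m + m = n • m := by module
  have e₄ : ω + 1 - ((n : ZMod N) + M) = ω - n - M + 1 := by ring
  have hD := couplingWeight_lower (MvPowerSeries.X : ZMod N → MvPowerSeries (ZMod N) K) M
    (show 0 ≤ n + M by omega) ω
  rw [chargedCoeff, chargedCoeff, lower, diagramWeight_consRow ε m _ _ _ hp,
    prod_cells_consRow hp, rightCoeff, map_mul, translate_prod_X, translate_val, map_div,
    map_unitAt, map_unitAt]
  simp only [e₁, e₂, e₃, e₄, hpω, Units.val_mul]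
  linear_combination (-(∏ c ∈ μ.cells, MvPowerSeries.X (ω - (c.2 : ZMod N))) *
    (unitAt U (ω - n - M + 1) (-((M + 1) • m) - M • ε + ε + -(n • ε)) /
        unitAt U (ω - n - M + 1) (-(M • m) - M • ε + ε + -(n • ε))).val *
    (diagramWeight ε m (unitAt U) ω (n • m) μ).val) * hD

theorem le_order_leftCoeff (ε m : G) (U : ZMod N → (MvPowerSeries (ZMod N) K)ˣ) (n : ℕ)
    (ω : ZMod N) : (n : ℕ∞) ≤ (leftCoeff ε m U n ω).order :=
  (MvPowerSeries.le_order_pow_of_constantCoeff_eq_zero n (MvPowerSeries.constantCoeff_X ω)).trans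
    (le_self_add.trans MvPowerSeries.le_order_mul)

theorem le_order_rightCoeff (ε m : G) (U : ZMod N → (MvPowerSeries (ZMod N) K)ˣ) (n : ℕ)
    (ω : ZMod N) : (n : ℕ∞) ≤ (rightCoeff ε m U n ω).order := by
  refine le_trans ?_ (le_self_add.trans MvPowerSeries.le_order_mul)
  refine le_trans ?_ (MvPowerSeries.le_order_prod _ _)
  refine le_trans (le_of_eq ?_) (Finset.card_nsmul_le_sum _ _ 1 fun i _ =>
    MvPowerSeries.one_le_order_iff_constCoeff_eq_zero.2 (MvPowerSeries.constantCoeff_X _))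
  simp

theorem hatY_eq (U : ZMod N → (MvPowerSeries (ZMod N) K)ˣ) (a : G) :
    hatY (fun ω => (U ω : MvPowerSeries (ZMod N) K)) a =
      Matrix.diagonal fun ω => (unitAt U (ω + 1) a).val := rfl

variable [NeZero N]

theorem hatY_inv (U : ZMod N → (MvPowerSeries (ZMod N) K)ˣ) (a : G) :
    (hatY (fun ω => (U ω : MvPowerSeries (ZMod N) K)) a)⁻¹ =
      Matrix.diagonal fun ω =>
        ((unitAt U (ω + 1) a)⁻¹).val := by
  refine Matrix.inv_eq_right_inv ?_
  simp [hatY_eq, Matrix.diagonal_mul_diagonal]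

theorem leftFactor_eq (ε m : G) (U : ZMod N → (MvPowerSeries (ZMod N) K)ˣ) (n : ℕ) :
    leftFactor ε m (fun ω => (U ω : MvPowerSeries (ZMod N) K)) n =
      1 - monomialOp ε 1 (leftCoeff ε m U n) := by
  have h₁ : zPow N G K 1 *
      ofMatrix G (couplingMatrix N K ^ n *
        hatY (fun ω => (U ω : MvPowerSeries (ZMod N) K)) (n • m + ε) * (cyclicShift N K)⁻¹) *
      shiftOp N K (-ε) =
      monomialOp ε 1 fun ω =>
        MvPowerSeries.X ω ^ n * (unitAt U (ω + 1) (n • m + ε)).val := by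
    rw [monomialOp, one_smul, Int.cast_one, cyclicShift_inv, hatY_eq, couplingMatrix,
      Matrix.diagonal_pow, Matrix.diagonal_mul_diagonal]
    rfl
  have e : ((n : ℤ) - 1) • m + ε + -((1 : ℤ) • ε) = ((n : ℤ) - 1) • m := by module
  rw [leftFactor, h₁, hatY_inv, ← monomialOp_zero ε, monomialOp_mul, add_zero]
  congr 2
  ext1 ω
  rw [translate_val, map_inv, map_unitAt, e, Int.cast_one, sub_add_cancel, leftCoeff,
    div_eq_mul_inv, Units.val_mul, mul_assoc]

theorem rightFactor_eq (ε m : G) (U : ZMod N → (MvPowerSeries (ZMod N) K)ˣ) (n : ℕ) :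
    rightFactor ε m (fun ω => (U ω : MvPowerSeries (ZMod N) K)) n =
      1 - monomialOp ε (-1) (rightCoeff ε m U n) := by
  have e₁ : -((-1 : ℤ) • ε) = ε := by module
  have e₂ : -(((-1 : ℤ)) : ZMod N) = 1 := by simp
  have e₃ : -(n : ZMod N) + ((n + 1 : ℕ) : ZMod N) = 1 := by push_cast; ring
  rw [rightFactor, monomialOp, e₁, e₂, hatY_inv, hatY_eq, Matrix.diagonal_mul_diagonal,
    couplingMatrix_mul_cyclicShift_inv_pow, mul_assoc (Matrix.diagonal _), shiftMatrix_mul_diagonal,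
    ← mul_assoc (Matrix.diagonal _), Matrix.diagonal_mul_diagonal, cyclicShift_pow,
    mul_assoc (Matrix.diagonal _), shiftMatrix_mul, e₃, mul_assoc, shiftOp_mul_ofMatrix,
    map_diagonal_mul_shiftMatrix, ← mul_assoc (zPow N G K _)]
  congr 5
  refine congrArg Matrix.diagonal (funext fun ω => ?_)
  rw [map_mul, translate_prod_X, ← Units.val_mul, translate_val, map_mul, map_inv,
    map_unitAt, map_unitAt, rightCoeff, div_eq_mul_inv, ← sub_eq_add_neg]

/-- The summand of the `θ`-transform of `χ̂` with charge `n` at the Young diagram `μ`, for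
`x = (n, μ)`. -/
def chargedTerm (ε m : G) (U : ZMod N → (MvPowerSeries (ZMod N) K)ˣ) (x : ℤ × YoungDiagram) :
    DiffOp N G K :=
  (-1) ^ x.1.natAbs * monomialOp ε x.1 (chargedCoeff ε m U x)

theorem neg_one_pow_natAbs_add_one {R : Type*} [Ring R] (n : ℤ) :
    (-1 : R) ^ (n + 1).natAbs = -(-1) ^ n.natAbs := by
  rcases Int.even_or_odd n with h | h
  · rw [(Int.natAbs_even.2 h).neg_one_pow, (Int.natAbs_odd.2 h.add_one).neg_one_pow]
  · rw [(Int.natAbs_odd.2 h).neg_one_pow, (Int.natAbs_even.2 h.add_one).neg_one_pow, neg_neg]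

theorem neg_one_pow_natAbs_add_one_mul {R : Type*} [Ring R] (n : ℤ) (a b : R) :
    (-1) ^ (n + 1).natAbs * (a * b) = -(a * ((-1) ^ n.natAbs * b)) := by
  rw [neg_one_pow_natAbs_add_one, neg_mul, ← mul_assoc, ← mul_assoc,
    ((Commute.neg_one_left a).pow_left _).eq]

theorem neg_one_pow_natAbs_mul {R : Type*} [Ring R] (n : ℤ) (a b : R) :
    (-1) ^ n.natAbs * (a * b) = -((-1) ^ (n + 1).natAbs * a * b) := by
  rw [neg_one_pow_natAbs_add_one, neg_mul, neg_mul, neg_neg, mul_assoc]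

theorem chargedTerm_raise (ε m : G) (U : ZMod N → (MvPowerSeries (ZMod N) K)ˣ) {P M : ℕ}
    {x : ℤ × YoungDiagram} (hx : x ∈ chargedBox P M) :
    chargedTerm ε m U (raise P x) =
      -(monomialOp ε 1 (leftCoeff ε m U (P + 1)) * chargedTerm ε m U x) := by
  refine Eq.trans ?_ (neg_one_pow_natAbs_add_one_mul _ _ _)
  rw [monomialOp_mul, add_comm 1]
  refine congrArg (fun c => _ * monomialOp ε (x.1 + 1) c) (funext fun ω => ?_)
  rw [chargedCoeff_raise ε m U hx, one_smul, Int.cast_one]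

theorem chargedTerm_lower (ε m : G) (U : ZMod N → (MvPowerSeries (ZMod N) K)ˣ) {P M : ℕ}
    {x : ℤ × YoungDiagram} (hx : x ∈ chargedBox P M) :
    chargedTerm ε m U (lower M x) =
      -(chargedTerm ε m U x * monomialOp ε (-1) (rightCoeff ε m U M)) := by
  have key := neg_one_pow_natAbs_mul (x.1 - 1) (monomialOp ε x.1 (chargedCoeff ε m U x))
    (monomialOp ε (-1) (rightCoeff ε m U M))
  rw [sub_add_cancel, monomialOp_mul] at key
  refine Eq.trans ?_ key
  refine congrArg (fun c => _ * monomialOp ε (x.1 - 1) c) (funext fun ω => ?_)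
  exact chargedCoeff_lower ε m U hx ω

theorem thetaTerm_eq (ε m : G) (U : ZMod N → (MvPowerSeries (ZMod N) K)ˣ) (n : ℤ) :
    thetaTerm ε m (fun ω => (U ω : MvPowerSeries (ZMod N) K)) n =
      (-1) ^ n.natAbs * monomialOp ε n fun ω =>
        translate N (n • m) (qqCharacter ε m (fun ω => (U ω : MvPowerSeries (ZMod N) K)) ω) *
          couplingWeight MvPowerSeries.X n ω := by
  rw [thetaTerm, couplingFactor_eq, hatChi, Matrix.diagonal_mul_diagonal, cyclicShift_zpow,
    Int.cast_neg, monomialOp]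
  simp only [mul_assoc]

/-! ### Expansion of the truncated products -/

/-- The product of the first `P` left factors, `Ŷ(x + ε)`, and the first `M` right factors, is a sum
over the charged Young diagrams whose rows and columns are bounded by `P` and `M`. -/
theorem truncated_factorization (ε m : G) (U : ZMod N → (MvPowerSeries (ZMod N) K)ˣ) (P M : ℕ) :
    leftOrderedProd
        (fun n => leftFactor ε m (fun ω => (U ω : MvPowerSeries (ZMod N) K)) (n + 1)) P *
        ofMatrix G (hatY (fun ω => (U ω : MvPowerSeries (ZMod N) K)) ε) *
        rightOrderedProd
          (fun n => rightFactor ε m (fun ω => (U ω : MvPowerSeries (ZMod N) K)) n) M =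
      ∑ x ∈ chargedBox P M, chargedTerm ε m U x := by
  induction P with
  | zero =>
    induction M with
    | zero =>
      rw [chargedBox_zero_zero, Finset.sum_singleton, leftOrderedProd, rightOrderedProd, one_mul,
        mul_one, chargedTerm, monomialOp_zero, hatY_eq, Int.natAbs_zero, pow_zero, one_mul]
      refine congrArg (fun c => ofMatrix G (Matrix.diagonal c)) (funext fun ω => ?_)
      simp [chargedCoeff, diagramWeight, couplingWeight_zero]
    | succ M ih =>
      rw [rightOrderedProd, ← mul_assoc, ih, rightFactor_eq, sum_chargedBox_succ_right,
        Finset.sum_congr rfl fun x hx => chargedTerm_lower ε m U hx, Finset.sum_neg_distrib,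
        ← Finset.sum_mul, mul_sub, mul_one, sub_eq_add_neg]
  | succ P ih =>
    rw [leftOrderedProd, mul_assoc, mul_assoc, ← mul_assoc (leftOrderedProd _ P), ih,
      leftFactor_eq, sum_chargedBox_succ_left,
      Finset.sum_congr rfl fun x hx => chargedTerm_raise ε m U hx, Finset.sum_neg_distrib,
      ← Finset.mul_sum, sub_mul, one_mul, sub_eq_add_neg]

/-! ### Convergence -/

/-- A charged diagram outside the box of bounds `k` and `k` contributes only in orders at least `k`,
since it arises from a smaller one by a factor of index at least `k`. -/
theorem le_order_chargedTerm (ε m : G) (U : ZMod N → (MvPowerSeries (ZMod N) K)ˣ) {k : ℕ}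
    {x : ℤ × YoungDiagram} (hx : x ∉ chargedBox k k) :
    (k : ℕ∞) ≤ (chargedTerm ε m U x).order := by
  obtain ⟨n, μ⟩ := x
  rw [mem_chargedBox, not_and_or] at hx
  rcases hx with hx | hx
  -- The first column has length `P + 1 - n` for some `P ≥ k`, and the diagram fits into the box of
  -- bounds `P + 1` and `M` for every large `M`.
  · obtain ⟨P, hP⟩ := Int.eq_ofNat_of_zero_le (show 0 ≤ (μ.colLen 0 : ℤ) + n - 1 by omega)
    obtain ⟨w, hw, h⟩ := exists_raise_eq (P := P) (M := μ.rowLen 0 + n.natAbs) (x := (n, μ))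
      (by rw [mem_chargedBox]; omega) (by rw [mem_chargedBox]; omega)
    rw [← h, chargedTerm_raise ε m U hw, MvPowerSeries.order_neg]
    refine le_trans ?_ (le_self_add.trans MvPowerSeries.le_order_mul)
    exact le_order_monomialOp ε 1 fun ω => le_trans (by norm_cast; omega)
      (le_order_leftCoeff ε m U (P + 1) ω)
  -- Dually, the first row has length `n + M + 1` for some `M ≥ k`.
  · obtain ⟨M, hM⟩ := Int.eq_ofNat_of_zero_le (show 0 ≤ (μ.rowLen 0 : ℤ) - n - 1 by omega)
    obtain ⟨w, hw, h⟩ := exists_lower_eq (P := μ.colLen 0 + n.natAbs) (M := M) (x := (n, μ))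
      (by rw [mem_chargedBox]; omega) (by rw [mem_chargedBox]; omega)
    rw [← h, chargedTerm_lower ε m U hw, MvPowerSeries.order_neg]
    refine le_trans ?_ (le_add_self.trans MvPowerSeries.le_order_mul)
    exact le_order_monomialOp ε (-1) fun ω => le_trans (by norm_cast; omega)
      (le_order_rightCoeff ε m U M ω)

theorem finite_coeff_chargedTerm_ne_zero (ε m : G) (U : ZMod N → (MvPowerSeries (ZMod N) K)ˣ)
    (d : ZMod N →₀ ℕ) :
    {x | MvPowerSeries.coeff d (chargedTerm ε m U x) ≠ 0}.Finite := by
  refine (chargedBox (d.degree + 1) (d.degree + 1)).finite_toSet.subset fun x hx => ?_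
  by_contra h
  refine hx (MvPowerSeries.coeff_of_lt_order (lt_of_lt_of_le ?_ (le_order_chargedTerm ε m U h)))
  exact_mod_cast Nat.lt_succ_self _

theorem tendsto_chargedBox : Tendsto (fun k => chargedBox k k) atTop atTop := by
  refine tendsto_atTop_finset_of_monotone (fun k l h => chargedBox_mono h h) ?_
  rintro ⟨n, μ⟩
  refine ⟨μ.colLen 0 + μ.rowLen 0 + n.natAbs, ?_⟩
  rw [mem_chargedBox]
  omega

/-- The summand of charge zero is `χ̂(x)` itself, so that the qq-characters converge. -/
theorem summable_qqTerm (ε m : G) (U : ZMod N → (MvPowerSeries (ZMod N) K)ˣ) (ω : ZMod N) :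
    Summable (qqTerm ε m (fun ω => (U ω : MvPowerSeries (ZMod N) K)) ω) := by
  refine summable_of_finite_coeff_ne_zero fun d => ?_
  refine ((finite_coeff_chargedTerm_ne_zero ε m U d).preimage
    (Prod.mk_right_injective (0 : ℤ)).injOn).subset fun μ hμ h => hμ ?_
  rw [chargedTerm, Int.natAbs_zero, pow_zero, one_mul] at h
  have := coeff_eq_zero_of_coeff_monomialOp_zero h ω
  rwa [chargedCoeff_eq, zero_smul, translate_zero, couplingWeight_zero, mul_one] at this

theorem hasSum_chargedTerm_of_charge (ε m : G) (U : ZMod N → (MvPowerSeries (ZMod N) K)ˣ) (n : ℤ) :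
    HasSum (fun μ => chargedTerm ε m U (n, μ))
      (thetaTerm ε m (fun ω => (U ω : MvPowerSeries (ZMod N) K)) n) := by
  have h : HasSum (fun μ => chargedCoeff ε m U (n, μ)) fun ω =>
      translate N (n • m) (qqCharacter ε m (fun ω => (U ω : MvPowerSeries (ZMod N) K)) ω) *
        couplingWeight MvPowerSeries.X n ω := by
    refine Pi.hasSum.2 fun ω => ?_
    simp only [chargedCoeff_eq]
    exact ((summable_qqTerm ε m U ω).hasSum.map (translate N (n • m))
      (continuous_translate _)).mul_right _
  have h' := h.map (AddMonoidHom.mk' (monomialOp (N := N) (K := K) ε n) (monomialOp_add ε n))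
    (continuous_monomialOp ε n)
  rw [thetaTerm_eq]
  exact h'.mul_left ((-1) ^ n.natAbs)

theorem exists_tendsto_leftOrderedProd (ε m : G) (U : ZMod N → (MvPowerSeries (ZMod N) K)ˣ) :
    ∃ L, Tendsto (leftOrderedProd
      fun n => leftFactor ε m (fun ω => (U ω : MvPowerSeries (ZMod N) K)) (n + 1)) atTop
        (𝓝 L) := by
  refine exists_tendsto_of_coeff_succ_eq fun k d hd => ?_
  rw [leftOrderedProd, leftFactor_eq, sub_mul, one_mul, map_sub, sub_eq_self]
  refine MvPowerSeries.coeff_of_lt_order (lt_of_lt_of_le ?_ (le_self_add.trans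
    MvPowerSeries.le_order_mul))
  refine lt_of_lt_of_le ?_ (le_order_monomialOp ε 1 (le_order_leftCoeff ε m U (k + 1)))
  exact_mod_cast hd.trans (Nat.lt_succ_self k)

theorem exists_tendsto_rightOrderedProd (ε m : G) (U : ZMod N → (MvPowerSeries (ZMod N) K)ˣ) :
    ∃ R, Tendsto (rightOrderedProd
      fun n => rightFactor ε m (fun ω => (U ω : MvPowerSeries (ZMod N) K)) n) atTop (𝓝 R) := by
  refine exists_tendsto_of_coeff_succ_eq fun k d hd => ?_
  rw [rightOrderedProd, rightFactor_eq, mul_sub, mul_one, map_sub, sub_eq_self]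
  refine MvPowerSeries.coeff_of_lt_order (lt_of_lt_of_le ?_ (le_add_self.trans
    MvPowerSeries.le_order_mul))
  refine lt_of_lt_of_le ?_ (le_order_monomialOp ε (-1) (le_order_rightCoeff ε m U k))
  exact_mod_cast hd

end Terms

end

end QQFactorization

theorem mainTheorem1 {N : ℕ} [NeZero N] {G K : Type*} [AddCommGroup G] [CommRing K]
    [MulSemiringAction (Multiplicative G) K] (ε m : G)
    (Y : ZMod N → MvPowerSeries (ZMod N) K) (hY : ∀ ω, IsUnit (Y ω)) :
    (∀ ω, Summable fun μ : YoungDiagram => QQFactorization.qqTerm ε m Y ω μ) ∧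
    ∃ L R : QQFactorization.DiffOp N G K,
      Tendsto (QQFactorization.leftOrderedProd
        fun n => QQFactorization.leftFactor ε m Y (n + 1)) atTop (𝓝 L) ∧
      Tendsto (QQFactorization.rightOrderedProd
        fun n => QQFactorization.rightFactor ε m Y n) atTop (𝓝 R) ∧
      HasSum (QQFactorization.thetaTerm ε m Y)
        (L * QQFactorization.ofMatrix G (QQFactorization.hatY Y ε) * R) := by
  choose U hU using hY
  obtain rfl : (fun ω => (U ω : MvPowerSeries (ZMod N) K)) = Y := funext hU
  obtain ⟨L, hL⟩ := QQFactorization.exists_tendsto_leftOrderedProd ε m U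
  obtain ⟨R, hR⟩ := QQFactorization.exists_tendsto_rightOrderedProd ε m U
  refine ⟨QQFactorization.summable_qqTerm ε m U, L, R, hL, hR, ?_⟩
  obtain ⟨S, hS⟩ := QQFactorization.summable_of_finite_coeff_ne_zero
    (QQFactorization.finite_coeff_chargedTerm_ne_zero ε m U)
  have hS' := hS
  unfold HasSum at hS'
  rw [SummationFilter.unconditional_filter] at hS'
  have hlim := (hL.mul_const (QQFactorization.ofMatrix G
    (QQFactorization.hatY (fun ω => (U ω : MvPowerSeries (ZMod N) K)) ε))).mul hR
  simp only [QQFactorization.truncated_factorization] at hlim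
  have hbox : Tendsto (fun k => ∑ x ∈ QQFactorization.chargedBox k k,
      QQFactorization.chargedTerm ε m U x) atTop (𝓝 S) :=
    hS'.comp QQFactorization.tendsto_chargedBox
  rw [tendsto_nhds_unique hlim hbox]
  exact hS.prod_fiberwise (QQFactorization.hasSum_chargedTerm_of_charge ε m U)
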